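/- Let $\omega\in\mathbb C$ be a primitive $8$th root of unity and $n\ge 1$. Put $X=\begin{pmatrix}0&1\\1&0\end{pmatrix}$, $Z=\begin{pmatrix}1&0\\0&-1\end{pmatrix}$, $H=\frac1{\sqrt2}\begin{pmatrix}1&1\\1&-1\end{pmatrix}$, $S=\begin{pmatrix}1&0\\0&\omega^2\end{pmatrix}$, $CZ=\mathrm{diag}(1,1,1,-1)$. For a $2\times 2$ matrix $U$ let $U_i=I_2^{\otimes(i-1)}\otimes U\otimes I_2^{\otimes(n-i)}$, and let $CZ_{i\to i+1}=I_2^{\otimes(i-1)}\otimes CZ\otimes I_2^{\otimes(n-i-1)}$. Let $\mathrm{Pauli}_n=\langle X_1,\dots,X_n,Z_1,\dots,Z_n,\omega^2 I\rangle\le U(2^n)$, let $\mathrm{Cliff}_n$ be the normalizer of $\mathrm{Pauli}_n$ in $U(2^n)$, and let $\mathcal C_n$ be the projective Clifford group, the quotient of $\mathrm{Cliff}_n$ by the group of scalar unitary matrices (global phases). Products in $\mathcal C_n$ are written from left to right, i.e. in the order opposite to that of matrix multiplication. Let $h_i,s_i,\Lambda_i\in\mathcal C_n$ be the classes of $H_i,S_i,CZ_{i\to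 i+1}$. Let $\mathcal{IN}_n\le\mathcal C_n$ be the inertia subgroup $$\mathcal{IN}_n=\begin{cases}\langle h_1,\ s_1^3h_1s_1h_1s_1\rangle, & n=1,\\ \langle h_1,\ h_2,\ s_2,\ h_1s_1^2h_1,\ M\rangle, & n=2,\\ \langle h_1,\dots,h_n,\ s_2,\dots,s_n,\ M,\ \Lambda_2,\dots,\Lambda_{n-1}\rangle, & n\ge 3,\end{cases}$$ where $M=h_2\Lambda_1s_2^2h_2h_1s_1^2h_2\Lambda_1h_2$. **Theorem.** The centralizer of $s_1^2$ in $\mathcal C_n$ is $$\mathrm{Cent}_{\mathcal C_n}(s_1^2)=\begin{cases}\langle h_1s_1h_1s_1^3h_1,\ s_1\rangle, & n=1,\\ \langle h_1s_1h_1s_1^3h_1,\ h_2,\dots,h_n,\ s_1,\dots,s_n,\ \Lambda_1,\dots,\Lambda_{n-1}\rangle, & n\ge 2.\end{cases}$$ If $n\ge2$, the generator $s_1$ can be omitted. For every $n\ge 1$ it is conjugate to $\mathcal{IN}_n$ in $\mathcal C_n$; in particular $\mathrm{Cent}_{\mathcal C_n}(s_1^2)=h_1s_1\,\mathcal{IN}_n\,s_1^3h_1$.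 -/

import Mathlib

namespace ProjClifford

/-! ### Matrices of the gates -/

/-- Computational basis of `n` qubits; index `i : Fin n` is qubit `i + 1`. -/
abbrev Basis (n : ℕ) := Fin n → Fin 2

/-- `2ⁿ × 2ⁿ` complex unitary matrices. -/
abbrev U (n : ℕ) := Matrix.unitaryGroup (Basis n) ℂ

/-- The tensor (Kronecker) product `A 0 ⊗ A 1 ⊗ ⋯ ⊗ A (n - 1)`. -/
def tensor {n : ℕ} (A : Fin n → Matrix (Fin 2) (Fin 2) ℂ) : Matrix (Basis n) (Basis n) ℂ :=
  Matrix.of fun x y => ∏ k, A k (x k) (y k)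

/-- `I₂ ⊗ ⋯ ⊗ I₂ ⊗ A ⊗ I₂ ⊗ ⋯ ⊗ I₂`, with `A` in position `i`. -/
def onQubitMatrix {n : ℕ} (i : Fin n) (A : Matrix (Fin 2) (Fin 2) ℂ) :
    Matrix (Basis n) (Basis n) ℂ :=
  tensor (Function.update (fun _ => 1) i A)

theorem tensor_mul {n : ℕ} (A B : Fin n → Matrix (Fin 2) (Fin 2) ℂ) :
    tensor A * tensor B = tensor (fun k => A k * B k) := by
  ext x y
  simp only [tensor, Matrix.mul_apply, Matrix.of_apply]
  rw [Finset.prod_univ_sum]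
  simp [Finset.prod_mul_distrib]

theorem tensor_one {n : ℕ} : tensor (fun _ : Fin n => 1) = 1 := by
  ext x y
  simp only [tensor, Matrix.of_apply]
  by_cases hxy : x = y
  · subst hxy; simp
  · obtain ⟨k, hk⟩ := Function.ne_iff.mp hxy
    rw [Matrix.one_apply_ne hxy]
    exact Finset.prod_eq_zero (Finset.mem_univ k) (Matrix.one_apply_ne hk)

theorem tensor_star {n : ℕ} (A : Fin n → Matrix (Fin 2) (Fin 2) ℂ) :
    star (tensor A) = tensor (fun k => star (A k)) := by
  ext x y
  simp [tensor, Matrix.star_apply]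

theorem onQubitMatrix_mul {n : ℕ} (i : Fin n) (A B : Matrix (Fin 2) (Fin 2) ℂ) :
    onQubitMatrix i A * onQubitMatrix i B = onQubitMatrix i (A * B) := by
  rw [onQubitMatrix, onQubitMatrix, tensor_mul, onQubitMatrix]
  congr 1
  ext1 k
  by_cases hk : k = i
  · subst hk; simp
  · simp [hk]

theorem onQubitMatrix_comm {n : ℕ} {i j : Fin n} (hij : i ≠ j) (A B : Matrix (Fin 2) (Fin 2) ℂ) :
    onQubitMatrix i A * onQubitMatrix j B = onQubitMatrix j B * onQubitMatrix i A := by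
  rw [onQubitMatrix, onQubitMatrix, tensor_mul, tensor_mul]
  congr 1
  ext1 k
  by_cases hk : k = i
  · subst hk; simp [hij]
  · simp [hk]

theorem onQubitMatrix_one {n : ℕ} (i : Fin n) : onQubitMatrix i 1 = 1 := by
  rw [onQubitMatrix, ← tensor_one]
  congr 1
  ext1 k
  by_cases hk : k = i
  · subst hk; simp
  · simp [hk]

theorem onQubitMatrix_star {n : ℕ} (i : Fin n) (A : Matrix (Fin 2) (Fin 2) ℂ) :
    star (onQubitMatrix i A) = onQubitMatrix i (star A) := by
  rw [onQubitMatrix, tensor_star, onQubitMatrix]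
  congr 1
  ext1 k
  by_cases hk : k = i
  · subst hk; simp
  · simp [hk]

/-- A one-qubit unitary acting on qubit `i` of `n` qubits. -/
def onQubit {n : ℕ} (i : Fin n) : Matrix.unitaryGroup (Fin 2) ℂ →* U n where
  toFun A := ⟨onQubitMatrix i A.1, by
    rw [Matrix.mem_unitaryGroup_iff, onQubitMatrix_star, onQubitMatrix_mul,
      Matrix.mem_unitaryGroup_iff.mp A.2, onQubitMatrix_one]⟩
  map_one' := Subtype.ext (onQubitMatrix_one i)
  map_mul' A B := Subtype.ext (onQubitMatrix_mul i A.1 B.1).symm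

theorem sq_of_primitive {ω : ℂ} (hω : IsPrimitiveRoot ω 8) : ω ^ 2 * ω ^ 2 = -1 := by
  have h1 : (ω ^ 4 - 1) * (ω ^ 4 + 1) = 0 := by linear_combination hω.pow_eq_one
  have h2 : ω ^ 4 ≠ 1 := hω.pow_ne_one_of_pos_of_lt (by norm_num) (by norm_num)
  have h3 : ω ^ 4 + 1 = 0 := (mul_eq_zero.mp h1).resolve_left (sub_ne_zero.mpr h2)
  linear_combination h3

theorem star_mul_of_primitive {ω : ℂ} (hω : IsPrimitiveRoot ω 8) :
    ω * (starRingEnd ℂ) ω = 1 := by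
  have h : ‖ω‖ = 1 := hω.norm'_eq_one (by norm_num)
  rw [Complex.mul_conj, Complex.normSq_eq_norm_sq, h]; norm_num

/-- The Pauli gate `X`. -/
def gateX : Matrix.unitaryGroup (Fin 2) ℂ := ⟨!![0, 1; 1, 0], by
  rw [Matrix.mem_unitaryGroup_iff]
  ext a b; fin_cases a <;> fin_cases b <;> simp [Matrix.mul_apply, Matrix.star_apply]⟩

/-- The Pauli gate `Z`. -/
def gateZ : Matrix.unitaryGroup (Fin 2) ℂ := ⟨!![1, 0; 0, -1], by
  rw [Matrix.mem_unitaryGroup_iff]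
  ext a b; fin_cases a <;> fin_cases b <;> simp [Matrix.mul_apply, Matrix.star_apply]⟩

theorem sqrt_two_inv_mul : ((√2 : ℝ) : ℂ)⁻¹ * ((√2 : ℝ) : ℂ)⁻¹ = 1 / 2 := by
  rw [← mul_inv, ← Complex.ofReal_mul, Real.mul_self_sqrt (by norm_num)]; norm_num

/-- The Hadamard gate `H`. -/
noncomputable def gateH : Matrix.unitaryGroup (Fin 2) ℂ :=
  ⟨((√2 : ℝ) : ℂ)⁻¹ • !![1, 1; 1, -1], by
  rw [Matrix.mem_unitaryGroup_iff]
  ext a b; fin_cases a <;> fin_cases b <;>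
    simp [Matrix.mul_apply, Matrix.star_apply, sqrt_two_inv_mul] <;> norm_num⟩

/-- The phase gate `S`. -/
def gateS {ω : ℂ} (hω : IsPrimitiveRoot ω 8) : Matrix.unitaryGroup (Fin 2) ℂ :=
  ⟨!![1, 0; 0, ω ^ 2], by
  rw [Matrix.mem_unitaryGroup_iff]
  have h := star_mul_of_primitive hω
  have h' : ω ^ 2 * (starRingEnd ℂ) ω ^ 2 = 1 := by rw [← mul_pow, h, one_pow]
  ext a b; fin_cases a <;> fin_cases b <;> simp [Matrix.mul_apply, Matrix.star_apply, h']⟩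

/-- The controlled `Z` gate on the qubits `i` and `j`: the sign of a basis vector changes
precisely when both qubits are in state `1`. -/
def gateCZ {n : ℕ} (i j : Fin n) : U n :=
  ⟨Matrix.diagonal fun x => if x i = 1 ∧ x j = 1 then -1 else 1, by
  rw [Matrix.mem_unitaryGroup_iff, Matrix.star_eq_conjTranspose, Matrix.diagonal_conjTranspose,
    Matrix.diagonal_mul_diagonal, ← Matrix.diagonal_one]
  congr 1
  ext1 x
  by_cases hx : x i = 1 ∧ x j = 1 <;> simp [hx]⟩

theorem smul_one_mem {n : ℕ} {c : ℂ} (hc : c * (starRingEnd ℂ) c = 1) :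
    c • (1 : Matrix (Basis n) (Basis n) ℂ) ∈ Matrix.unitaryGroup (Basis n) ℂ := by
  rw [Matrix.mem_unitaryGroup_iff, star_smul, star_one, smul_mul_smul_comm, one_mul]
  rw [show c * star c = 1 from hc, one_smul]

/-- The global phase `ω² I`. -/
def phaseGate (n : ℕ) {ω : ℂ} (hω : IsPrimitiveRoot ω 8) : U n :=
  ⟨(ω ^ 2) • 1, smul_one_mem (by
    rw [map_pow, ← mul_pow, star_mul_of_primitive hω, one_pow])⟩

/-! ### The Pauli group, the Clifford group, the projective Clifford group -/

/-- The `n`-qubit Pauli group `⟨X₁, …, Xₙ, Z₁, …, Zₙ, ω² I⟩`. -/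
def pauli (n : ℕ) {ω : ℂ} (hω : IsPrimitiveRoot ω 8) : Subgroup (U n) :=
  Subgroup.closure
    (Set.range (fun i : Fin n => onQubit i gateX) ∪ Set.range (fun i : Fin n => onQubit i gateZ) ∪
      {phaseGate n hω})

/-- The `n`-qubit Clifford group: the normalizer of the Pauli group in the unitary group. -/
def clifford (n : ℕ) {ω : ℂ} (hω : IsPrimitiveRoot ω 8) : Subgroup (U n) :=
  Subgroup.normalizer (pauli n hω : Set (U n))

/-- The unitary scalar matrices (global phases). -/
def phases (n : ℕ) : Subgroup (U n) where
  carrier := {u | ∃ c : ℂ, (u : Matrix (Basis n) (Basis n) ℂ) = c • 1}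
  one_mem' := ⟨1, by simp⟩
  mul_mem' := by
    rintro u v ⟨c, hc⟩ ⟨d, hd⟩
    exact ⟨c * d, by rw [Submonoid.coe_mul, hc, hd, smul_mul_smul_comm, one_mul]⟩
  inv_mem' := by
    rintro u ⟨c, hc⟩
    exact ⟨star c, by
      rw [show (u⁻¹ : U n).1 = star u.1 from rfl, hc, star_smul, star_one]⟩

instance phases_normal (n : ℕ) : (phases n).Normal where
  conj_mem := by
    rintro u ⟨c, hc⟩ g
    refine ⟨c, ?_⟩
    have h : g * u * g⁻¹ = u := by
      rw [mul_inv_eq_iff_eq_mul]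
      apply Subtype.ext
      rw [Submonoid.coe_mul, Submonoid.coe_mul, hc]
      simp
    rw [h, hc]

/-- The projective Clifford group `𝓒ₙ`, the Clifford group modulo global phases. Products are
read from left to right, as in circuits: `a * b` is the class of the matrix product `B * A`,
whence the opposite group. -/
abbrev C (n : ℕ) {ω : ℂ} (hω : IsPrimitiveRoot ω 8) : Type :=
  (↥(clifford n hω) ⧸ (phases n).subgroupOf (clifford n hω))ᵐᵒᵖ

/-- The class of a Clifford operator in the projective Clifford group. -/
def toC {n : ℕ} {ω : ℂ} (hω : IsPrimitiveRoot ω 8) (u : U n) (hu : u ∈ clifford n hω) : C n hω :=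
  MulOpposite.op (QuotientGroup.mk (⟨u, hu⟩ : ↥(clifford n hω)))

/-! ### The gates are Clifford operators -/

section mem

variable {n : ℕ} {ω : ℂ} (hω : IsPrimitiveRoot ω 8)

theorem X_mem (i : Fin n) : onQubit i gateX ∈ pauli n hω :=
  Subgroup.subset_closure (Or.inl (Or.inl ⟨i, rfl⟩))

theorem Z_mem (i : Fin n) : onQubit i gateZ ∈ pauli n hω :=
  Subgroup.subset_closure (Or.inl (Or.inr ⟨i, rfl⟩))

theorem phase_mem : phaseGate n hω ∈ pauli n hω :=
  Subgroup.subset_closure (Or.inr rfl)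

theorem mem_clifford {u : U n} {k : ℕ} (hk : u ^ (k + 1) = 1)
    (hX : ∀ i, u * onQubit i gateX * u⁻¹ ∈ pauli n hω)
    (hZ : ∀ i, u * onQubit i gateZ * u⁻¹ ∈ pauli n hω) : u ∈ clifford n hω := by
  have key : ∀ p ∈ pauli n hω, u * p * u⁻¹ ∈ pauli n hω := by
    intro p hp
    induction hp using Subgroup.closure_induction with
    | mem x hx =>
      rcases hx with (⟨i, rfl⟩ | ⟨i, rfl⟩) | hx
      · exact hX i
      · exact hZ i
      · have hx' : x = phaseGate n hω := hx
        have h : u * x * u⁻¹ = phaseGate n hω := by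
          rw [mul_inv_eq_iff_eq_mul, hx']
          apply Subtype.ext
          simp [phaseGate]
        rw [h]; exact phase_mem hω
    | one => simp
    | mul x y _ _ hx hy => rw [← conj_mul]; exact Subgroup.mul_mem _ hx hy
    | inv x _ hx => rw [← conj_inv]; exact Subgroup.inv_mem _ hx
  have pow : ∀ m : ℕ, ∀ p ∈ pauli n hω, u ^ m * p * (u ^ m)⁻¹ ∈ pauli n hω := by
    intro m
    induction m with
    | zero => simp
    | succ m ih =>
      intro p hp
      have := key _ (ih p hp)
      rw [pow_succ', mul_inv_rev]
      simpa [mul_assoc] using this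
  rw [clifford, Subgroup.mem_normalizer_iff]
  intro p
  refine ⟨key p, fun hp => ?_⟩
  have h := pow k _ hp
  have h1 : u ^ k * u = 1 := by rw [← pow_succ, hk]
  have h2 : u ^ k = u⁻¹ := eq_inv_of_mul_eq_one_left h1
  rw [h2] at h
  simpa [mul_assoc] using h

theorem onQubit_comm {i j : Fin n} (hij : i ≠ j) (a b : Matrix.unitaryGroup (Fin 2) ℂ) :
    onQubit i a * onQubit j b = onQubit j b * onQubit i a :=
  Subtype.ext (onQubitMatrix_comm hij a.1 b.1)

theorem conj_mem_of {i j : Fin n} {a b : Matrix.unitaryGroup (Fin 2) ℂ}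
    (hb : onQubit j b ∈ pauli n hω) (h : onQubit j (a * b * a⁻¹) ∈ pauli n hω) :
    onQubit i a * onQubit j b * (onQubit i a)⁻¹ ∈ pauli n hω := by
  by_cases hij : i = j
  · subst hij; rwa [← map_inv, ← map_mul, ← map_mul]
  · rw [onQubit_comm hij, mul_inv_cancel_right]; exact hb

theorem gateH_sq : gateH * gateH = 1 := by
  apply Subtype.ext
  ext a b
  fin_cases a <;> fin_cases b <;>
    simp [gateH, sqrt_two_inv_mul] <;> norm_num

theorem gateH_mul_X : gateH * gateX = gateZ * gateH := by
  apply Subtype.ext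
  ext a b
  fin_cases a <;> fin_cases b <;> simp [gateH, gateX, gateZ]

theorem gateH_mul_Z : gateH * gateZ = gateX * gateH := by
  apply Subtype.ext
  ext a b
  fin_cases a <;> fin_cases b <;> simp [gateH, gateX, gateZ]

theorem gateS_sq : gateS hω * gateS hω = gateZ := by
  apply Subtype.ext
  have h := sq_of_primitive hω
  ext a b
  fin_cases a <;> fin_cases b <;> simp [gateS, gateZ, h]

theorem gateZ_sq : gateZ * gateZ = 1 := by
  apply Subtype.ext
  ext a b
  fin_cases a <;> fin_cases b <;> simp [gateZ]

theorem S_mul_X (i : Fin n) : onQubit i (gateS hω) * onQubit i gateX =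
    (phaseGate n hω * (onQubit i gateX * onQubit i gateZ)) * onQubit i (gateS hω) := by
  apply Subtype.ext
  have h := sq_of_primitive hω
  have e : (gateS hω).1 * gateX.1 = ω ^ 2 • (gateX.1 * gateZ.1 * (gateS hω).1) := by
    ext a b
    fin_cases a <;> fin_cases b <;> simp [gateS, gateZ, gateX, Matrix.mul_apply, h]
  have smul : ∀ (c : ℂ) (A : Matrix (Fin 2) (Fin 2) ℂ),
      onQubitMatrix i (c • A) = c • onQubitMatrix i A := by
    intro c A
    ext x y
    simp only [onQubitMatrix, tensor, Matrix.of_apply, Matrix.smul_apply, smul_eq_mul]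
    rw [← Finset.mul_prod_erase _ _ (Finset.mem_univ i),
      ← Finset.mul_prod_erase Finset.univ (fun k => (Function.update (fun _ => 1) i A : Fin n →
        Matrix (Fin 2) (Fin 2) ℂ) k (x k) (y k)) (Finset.mem_univ i)]
    simp only [Function.update_self, Matrix.smul_apply, smul_eq_mul, mul_assoc]
    congr 2
    refine Finset.prod_congr rfl fun k hk => ?_
    rw [Function.update_of_ne (Finset.ne_of_mem_erase hk),
      Function.update_of_ne (Finset.ne_of_mem_erase hk)]
  simp only [onQubit, phaseGate, MonoidHom.coe_mk, OneHom.coe_mk, Submonoid.coe_mul,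
    onQubitMatrix_mul, e, smul, smul_mul_assoc, one_mul]

theorem H_mem (i : Fin n) : onQubit i gateH ∈ clifford n hω := by
  refine mem_clifford hω (k := 1) ?_ ?_ ?_
  · rw [← map_pow, pow_two, gateH_sq, map_one]
  · intro j
    refine conj_mem_of hω (X_mem hω j) ?_
    rw [gateH_mul_X, mul_inv_cancel_right]; exact Z_mem hω j
  · intro j
    refine conj_mem_of hω (Z_mem hω j) ?_
    rw [gateH_mul_Z, mul_inv_cancel_right]; exact X_mem hω j

theorem S_mem (i : Fin n) : onQubit i (gateS hω) ∈ clifford n hω := by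
  refine mem_clifford hω (k := 3) ?_ ?_ ?_
  · rw [← map_pow, show gateS hω ^ (3 + 1) = (gateS hω * gateS hω) * (gateS hω * gateS hω) by
      simp only [pow_succ, pow_zero, one_mul, mul_assoc], gateS_sq, gateZ_sq, map_one]
  · intro j
    by_cases hij : i = j
    · subst hij
      rw [S_mul_X, mul_inv_cancel_right]
      exact Subgroup.mul_mem _ (phase_mem hω) (Subgroup.mul_mem _ (X_mem hω i) (Z_mem hω i))
    · rw [onQubit_comm hij, mul_inv_cancel_right]; exact X_mem hω j
  · intro j
    refine conj_mem_of hω (Z_mem hω j) ?_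
    rw [← gateS_sq hω, ← mul_assoc, mul_inv_cancel_right, gateS_sq]; exact Z_mem hω j

theorem onQubit_Z (i : Fin n) : (onQubit i gateZ).1 =
    Matrix.diagonal fun x : Basis n => if x i = 1 then -1 else 1 := by
  ext x y
  simp only [onQubit, MonoidHom.coe_mk, OneHom.coe_mk, onQubitMatrix, tensor, Matrix.of_apply]
  rw [← Finset.mul_prod_erase _ _ (Finset.mem_univ i), Function.update_self]
  by_cases hxy : x = y
  · subst hxy
    rw [Finset.prod_eq_one, Matrix.diagonal_apply_eq]
    · rcases Fin.exists_fin_two.mp ⟨x i, rfl⟩ with h | h <;> simp [h, gateZ]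
    · intro k hk
      rw [Function.update_of_ne (Finset.ne_of_mem_erase hk), Matrix.one_apply_eq]
  · rw [Matrix.diagonal_apply_ne _ hxy]
    obtain ⟨k, hk⟩ := Function.ne_iff.mp hxy
    by_cases hki : k = i
    · subst hki
      have : gateZ.1 (x k) (y k) = 0 := by
        revert hk
        generalize x k = a
        generalize y k = b
        fin_cases a <;> fin_cases b <;> simp [gateZ]
      rw [this, zero_mul]
    · rw [Finset.prod_eq_zero (Finset.mem_erase.mpr ⟨hki, Finset.mem_univ k⟩), mul_zero]
      rw [Function.update_of_ne hki, Matrix.one_apply_ne hk]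

theorem X_apply (i : Fin n) (x y : Basis n) :
    (onQubit i gateX).1 x y = 0 ∨ (x i ≠ y i ∧ ∀ k, k ≠ i → x k = y k) := by
  by_contra! hc
  obtain ⟨h0, h1⟩ := hc
  simp only [onQubit, MonoidHom.coe_mk, OneHom.coe_mk, onQubitMatrix, tensor, Matrix.of_apply]
    at h0
  rw [Finset.prod_ne_zero_iff] at h0
  have hi : x i ≠ y i := by
    have := h0 i (Finset.mem_univ i)
    rw [Function.update_self] at this
    intro h
    rw [h] at this
    revert this
    generalize y i = b
    fin_cases b <;> simp [gateX]
  obtain ⟨k, hk, hk'⟩ := h1 hi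
  have := h0 k (Finset.mem_univ k)
  rw [Function.update_of_ne hk, Matrix.one_apply_ne hk'] at this
  exact this rfl

theorem gateCZ_sq (i j : Fin n) : gateCZ i j * gateCZ i j = 1 := by
  apply Subtype.ext
  simp only [gateCZ, Submonoid.coe_mul, Matrix.diagonal_mul_diagonal, Submonoid.coe_one]
  rw [← Matrix.diagonal_one]
  congr 1
  ext1 x
  by_cases hx : x i = 1 ∧ x j = 1 <;> simp [hx]

theorem gateCZ_comm (i j : Fin n) : gateCZ i j = gateCZ j i := by
  apply Subtype.ext
  simp only [gateCZ, and_comm]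

theorem CZ_mul_X {i j : Fin n} (hij : i ≠ j) : gateCZ i j * onQubit i gateX =
    onQubit j gateZ * onQubit i gateX * gateCZ i j := by
  apply Subtype.ext
  rw [Submonoid.coe_mul, Submonoid.coe_mul, Submonoid.coe_mul, onQubit_Z]
  simp only [gateCZ]
  ext x y
  rw [Matrix.diagonal_mul, Matrix.mul_diagonal, Matrix.diagonal_mul]
  rcases X_apply i x y with h | ⟨h, h'⟩
  · simp [h]
  · rw [← h' j hij.symm]
    revert h
    generalize x i = a
    generalize y i = b
    generalize x j = c
    fin_cases a <;> fin_cases b <;> fin_cases c <;> simp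

theorem CZ_mul_X_of_ne {i j k : Fin n} (hi : i ≠ k) (hj : j ≠ k) :
    gateCZ i j * onQubit k gateX = onQubit k gateX * gateCZ i j := by
  apply Subtype.ext
  rw [Submonoid.coe_mul, Submonoid.coe_mul]
  simp only [gateCZ]
  ext x y
  rw [Matrix.diagonal_mul, Matrix.mul_diagonal]
  rcases X_apply k x y with h | ⟨h, h'⟩
  · simp [h]
  · rw [h' i hi, h' j hj, mul_comm]

theorem CZ_mul_Z (i j k : Fin n) :
    gateCZ i j * onQubit k gateZ = onQubit k gateZ * gateCZ i j := by
  apply Subtype.ext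
  rw [Submonoid.coe_mul, Submonoid.coe_mul, onQubit_Z]
  simp only [gateCZ, Matrix.diagonal_mul_diagonal, mul_comm]

theorem CZ_mem {i j : Fin n} (hij : i ≠ j) : gateCZ i j ∈ clifford n hω := by
  refine mem_clifford hω (k := 1) ?_ ?_ ?_
  · rw [pow_two, gateCZ_sq]
  · intro k
    by_cases hi : i = k
    · subst hi
      rw [CZ_mul_X hij, mul_inv_cancel_right]
      exact Subgroup.mul_mem _ (Z_mem hω j) (X_mem hω i)
    by_cases hj : j = k
    · subst hj
      rw [gateCZ_comm, CZ_mul_X hij.symm, mul_inv_cancel_right]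
      exact Subgroup.mul_mem _ (Z_mem hω i) (X_mem hω j)
    · rw [CZ_mul_X_of_ne hi hj, mul_inv_cancel_right]; exact X_mem hω k
  · intro k
    rw [CZ_mul_Z, mul_inv_cancel_right]; exact Z_mem hω k

end mem

/-! ### Elements and subgroups of the projective Clifford group

Indices are shifted by one: `h hω i`, `s hω i` and `Λ hω k hk` are the Hadamard gate on qubit
`i + 1`, the phase gate on qubit `i + 1`, and the controlled `Z` gate on the qubits `k + 1` and
`k + 2`. -/

/-- The class of the Hadamard gate. -/
noncomputable def h {n : ℕ} {ω : ℂ} (hω : IsPrimitiveRoot ω 8) (i : Fin n) : C n hω :=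
  toC hω (onQubit i gateH) (H_mem hω i)

/-- The class of the phase gate. -/
def s {n : ℕ} {ω : ℂ} (hω : IsPrimitiveRoot ω 8) (i : Fin n) : C n hω :=
  toC hω (onQubit i (gateS hω)) (S_mem hω i)

/-- The class of the controlled `Z` gate on two consecutive qubits. -/
def Λ {n : ℕ} {ω : ℂ} (hω : IsPrimitiveRoot ω 8) (k : ℕ) (hk : k + 1 < n) : C n hω :=
  toC hω (gateCZ ⟨k, by omega⟩ ⟨k + 1, hk⟩) (CZ_mem hω (by simp [Fin.ext_iff]))

/-- The element `M = h₂ Λ₁ s₂² h₂ h₁ s₁² h₂ Λ₁ h₂`. -/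
noncomputable def M {n : ℕ} {ω : ℂ} (hω : IsPrimitiveRoot ω 8) (hn : 2 ≤ n) : C n hω :=
  let h₁ : C n hω := h hω ⟨0, by omega⟩
  let h₂ : C n hω := h hω ⟨1, by omega⟩
  let s₁ : C n hω := s hω ⟨0, by omega⟩
  let s₂ : C n hω := s hω ⟨1, by omega⟩
  let Λ₁ : C n hω := Λ hω 0 (by omega)
  h₂ * Λ₁ * s₂ ^ 2 * h₂ * h₁ * s₁ ^ 2 * h₂ * Λ₁ * h₂

/-- The inertia subgroup `𝓘𝓝ₙ` of `𝓒ₙ`, for `n ≥ 1` (the value at `n = 0` is never used):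
`⟨h₁, s₁³ h₁ s₁ h₁ s₁⟩` for `n = 1`, `⟨h₁, h₂, s₂, h₁ s₁² h₁, M⟩` for `n = 2`, and
`⟨h₁, …, hₙ, s₂, …, sₙ, M, Λ₂, …, Λₙ₋₁⟩` for `n ≥ 3`. -/
noncomputable def inertia {ω : ℂ} (hω : IsPrimitiveRoot ω 8) : (n : ℕ) → Subgroup (C n hω)
  | 0 => ⊥
  | 1 => Subgroup.closure {h hω 0, s hω 0 ^ 3 * h hω 0 * s hω 0 * h hω 0 * s hω 0}
  | 2 => Subgroup.closure
      {h hω 0, h hω 1, s hω 1, h hω 0 * s hω 0 ^ 2 * h hω 0, M hω le_rfl}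
  | n + 3 => Subgroup.closure
      ({u | ∃ i, u = h hω i} ∪ {u | ∃ i, i ≠ 0 ∧ u = s hω i} ∪ {M hω (by omega)} ∪
        {u | ∃ (k : ℕ) (hk : k + 1 < n + 3), 1 ≤ k ∧ u = Λ hω k hk})

end ProjClifford

/-! Modulo phases, the Pauli operators are the vectors of the symplectic space of dimension `2n`
over the field with two elements; `form` records whether two of them commute. A Clifford operator
permutes these vectors and preserves `form`. The element `s₁²` is the class of `Z₁`, so its
centralizer consists of the classes of the operators that fix the word of `Z₁` up to a scalar
(`toC_mem_centralizer_iff`).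

The main tool is the rotation `rot t = (1 + J) / √2`, where `J` is the multiple of the word `t` with
square `-1`. It acts as a symplectic transvection: it fixes the words commuting with `t` and adds
`t` to the others; its square is the word `t` up to a phase. The gates are rotations in disguise:
`S` is `rot Z` or its inverse up to a phase, `H` is `Z` times the inverse of `rot Y` (with `Y =
XZ`), and `CZ` is obtained from rotations about `Zᵢ`, `Zⱼ` and `ZᵢZⱼ`.

Suppose that a subgroup contains the phases, the word `X₁` and every rotation about a word commuting
with `Z₁`. Then it contains every Clifford operator fixing `Z₁`: transvections move the images of
the letters back one qubit at a time, and an operator fixing all letters is a Pauli word times a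
phase (`mem_of_act_zLetter`). If `v` and `w` anticommute, conjugating `rot w` by `rot v` gives `rot
(v + w)` or its inverse. A combinatorial closure argument (`mem_of_closed`) therefore reduces the
rotations to a short list, with the single exception of `rot Z₁`, which needs a separate source.

For the listed generators with `n ≥ 2`, that source is the relation between `CZ` and diagonal
rotations, which makes `s₁` superfluous. For the inertia group, conjugation by `h₁ s₁` carries `Y₁`
to `Z₁`, and `M` becomes, up to a Pauli word and inversion, the rotation about `Z₁X₂`. Then `rot Z₁`
comes from the extra generator when `n = 2`, and from a relation among seven diagonal rotations when
`n ≥ 3`. -/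

namespace ProjClifford

open scoped Fin.CommRing

/-! ### Pauli words -/

/-- The word `(a, b)` stands for the Pauli operator `X^a Z^b`. -/
abbrev Word (n : ℕ) := Basis n × Basis n

/-- The character of `ℤ/2` with values `±1`. -/
def sgn (a : Fin 2) : ℂ := if a = 0 then 1 else -1

theorem sgn_zero : sgn 0 = 1 := by simp [sgn]

theorem sgn_one : sgn 1 = -1 := by simp [sgn]

theorem sgn_add (a b : Fin 2) : sgn (a + b) = sgn a * sgn b := by
  fin_cases a <;> fin_cases b <;> simp [sgn]

theorem sgn_mul_self (a : Fin 2) : sgn a * sgn a = 1 := by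
  fin_cases a <;> simp [sgn]

theorem star_sgn (a : Fin 2) : star (sgn a) = sgn a := by
  fin_cases a <;> simp [sgn]

theorem sgn_injective {a b : Fin 2} (hab : sgn a = sgn b) : a = b := by
  revert hab
  fin_cases a <;> fin_cases b <;> simp [sgn] <;> norm_num

theorem fin_two_add_self (a : Fin 2) : a + a = 0 := by
  fin_cases a <;> rfl

theorem basis_add_self {n : ℕ} (a : Basis n) : a + a = 0 :=
  funext fun k => fin_two_add_self (a k)

theorem word_add_self {n : ℕ} (v : Word n) : v + v = 0 :=
  Prod.ext (basis_add_self _) (basis_add_self _)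

theorem word_add_cancel {n : ℕ} (v w : Word n) : v + (v + w) = w := by
  rw [← add_assoc, word_add_self, zero_add]

/-- The commutation form of Pauli words. -/
def form {n : ℕ} (v w : Word n) : Fin 2 := v.1 ⬝ᵥ w.2 + v.2 ⬝ᵥ w.1

theorem form_comm {n : ℕ} (v w : Word n) : form v w = form w v := by
  rw [form, form, dotProduct_comm v.1, dotProduct_comm v.2, add_comm]

theorem form_self {n : ℕ} (v : Word n) : form v v = 0 := by
  rw [form, dotProduct_comm v.2, fin_two_add_self]

theorem form_add_left {n : ℕ} (u v w : Word n) : form (u + v) w = form u w + form v w := by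
  simp only [form, Prod.fst_add, Prod.snd_add, add_dotProduct]
  ring

theorem form_add_right {n : ℕ} (u v w : Word n) : form u (v + w) = form u v + form u w := by
  rw [form_comm, form_add_left, form_comm v, form_comm w]

/-- The matrix of `X^a Z^b`. -/
def wordMatrix {n : ℕ} (v : Word n) : Matrix (Basis n) (Basis n) ℂ :=
  Matrix.of fun x y => if x = y + v.1 then sgn (v.2 ⬝ᵥ y) else 0

theorem wordMatrix_mul {n : ℕ} (v w : Word n) :
    wordMatrix v * wordMatrix w = sgn (v.2 ⬝ᵥ w.1) • wordMatrix (v + w) := by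
  ext x z
  rw [Matrix.mul_apply, Finset.sum_eq_single (z + w.1)]
  · simp only [wordMatrix, Matrix.of_apply, Matrix.smul_apply, Prod.fst_add, Prod.snd_add,
      smul_eq_mul, if_true]
    rw [add_assoc z, add_comm w.1]
    split_ifs
    · rw [dotProduct_add, add_dotProduct, sgn_add, sgn_add]; ring
    · simp
  · intro y _ hy
    simp [wordMatrix, hy]
  · simp

theorem wordMatrix_zero {n : ℕ} : wordMatrix (0 : Word n) = 1 := by
  ext x y
  simp [wordMatrix, Matrix.one_apply, sgn]

theorem wordMatrix_mul_self {n : ℕ} (v : Word n) :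
    wordMatrix v * wordMatrix v = sgn (v.2 ⬝ᵥ v.1) • (1 : Matrix (Basis n) (Basis n) ℂ) := by
  rw [wordMatrix_mul, word_add_self, wordMatrix_zero]

theorem star_wordMatrix {n : ℕ} (v : Word n) :
    star (wordMatrix v) = sgn (v.2 ⬝ᵥ v.1) • wordMatrix v := by
  ext x y
  simp only [wordMatrix, Matrix.star_apply, Matrix.of_apply, Matrix.smul_apply, smul_eq_mul]
  by_cases hxy : x = y + v.1
  · have h' : y = x + v.1 := by rw [hxy, add_assoc, basis_add_self, add_zero]
    rw [if_pos h', if_pos hxy, star_sgn, hxy, dotProduct_add, sgn_add, mul_comm]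
  · have h' : y ≠ x + v.1 := by
      rintro rfl
      exact hxy (by rw [add_assoc, basis_add_self, add_zero])
    rw [if_neg h', if_neg hxy, star_zero, mul_zero]

theorem wordMatrix_comm {n : ℕ} (v w : Word n) :
    wordMatrix v * wordMatrix w = sgn (form v w) • (wordMatrix w * wordMatrix v) := by
  rw [wordMatrix_mul, wordMatrix_mul, smul_smul, add_comm w v, form, sgn_add, mul_right_comm,
    dotProduct_comm w.2, sgn_mul_self, one_mul]

/-- The Pauli operator `X^a Z^b`. -/
def word {n : ℕ} (v : Word n) : U n :=
  ⟨wordMatrix v, by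
    rw [Matrix.mem_unitaryGroup_iff, star_wordMatrix, mul_smul_comm, wordMatrix_mul_self,
      smul_smul, sgn_mul_self, one_smul]⟩

theorem coe_word {n : ℕ} (v : Word n) : (word v).1 = wordMatrix v := rfl

/-! ### Rotations -/

/-- The skew-Hermitian multiple of a Pauli word by a fourth root of unity. -/
noncomputable def skew {n : ℕ} (v : Word n) : Matrix (Basis n) (Basis n) ℂ :=
  (if v.2 ⬝ᵥ v.1 = 0 then Complex.I else 1) • wordMatrix v

/-- The last two identities are exactly what makes the square of `skew v` equal to `-1` and its
adjoint equal to its negative; most later arguments need nothing more about the scalar. -/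
theorem exists_skew {n : ℕ} (v : Word n) :
    ∃ c : ℂ, c ≠ 0 ∧ skew v = c • wordMatrix v ∧ c * c * sgn (v.2 ⬝ᵥ v.1) = -1 ∧
      star c * sgn (v.2 ⬝ᵥ v.1) = -c := by
  refine ⟨_, ?_, rfl, ?_, ?_⟩ <;> split_ifs with hv
  · exact Complex.I_ne_zero
  · exact one_ne_zero
  · simp [sgn, hv]
  · simp [sgn, hv]
  · simp [sgn, hv]
  · simp [sgn, hv]

theorem skew_mul_self {n : ℕ} (v : Word n) : skew v * skew v = -1 := by
  obtain ⟨c, -, hc, h1, -⟩ := exists_skew v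
  rw [hc, smul_mul_smul_comm, wordMatrix_mul_self, smul_smul, h1, neg_one_smul]

theorem star_skew {n : ℕ} (v : Word n) : star (skew v) = -skew v := by
  obtain ⟨c, -, hc, -, h2⟩ := exists_skew v
  rw [hc, star_smul, star_wordMatrix, smul_smul, h2, neg_smul]

theorem skew_comm {n : ℕ} (v w : Word n) :
    skew v * skew w = sgn (form v w) • (skew w * skew v) := by
  obtain ⟨c, -, hc, -, -⟩ := exists_skew v
  obtain ⟨d, -, hd, -, -⟩ := exists_skew w
  rw [hc, hd, smul_mul_smul_comm, smul_mul_smul_comm, wordMatrix_comm v w, smul_smul, smul_smul]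
  congr 1
  ring

/-- The rotation `(1 + J) / √2` for the skew-Hermitian operator `J` of a Pauli word. -/
noncomputable def rot {n : ℕ} (v : Word n) : U n :=
  ⟨((√2 : ℝ) : ℂ)⁻¹ • (1 + skew v), by
    rw [Matrix.mem_unitaryGroup_iff, star_smul, star_add, star_one, star_skew,
      smul_mul_smul_comm, show star ((√2 : ℝ) : ℂ)⁻¹ = ((√2 : ℝ) : ℂ)⁻¹ by simp, sqrt_two_inv_mul,
      show (1 + skew v) * (1 + -skew v) = 1 - skew v * skew v by noncomm_ring, skew_mul_self,
      show (1 : Matrix (Basis n) (Basis n) ℂ) - -1 = (2 : ℂ) • 1 by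
        rw [two_smul, sub_neg_eq_add], smul_smul]
    norm_num⟩

theorem coe_rot {n : ℕ} (v : Word n) : (rot v).1 = ((√2 : ℝ) : ℂ)⁻¹ • (1 + skew v) := rfl

theorem coe_rot_inv {n : ℕ} (v : Word n) :
    (rot v)⁻¹.1 = ((√2 : ℝ) : ℂ)⁻¹ • (1 - skew v) := by
  rw [show (rot v)⁻¹.1 = star (rot v).1 from rfl, coe_rot, star_smul, star_add, star_one,
    star_skew, sub_eq_add_neg]
  simp

theorem rot_mul_self {n : ℕ} (v : Word n) : (rot v * rot v).1 = skew v := by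
  rw [Submonoid.coe_mul, coe_rot, smul_mul_smul_comm, sqrt_two_inv_mul,
    show (1 + skew v) * (1 + skew v) = 1 + (2 : ℂ) • skew v + skew v * skew v by
      rw [two_smul]; noncomm_ring, skew_mul_self,
    show (1 : Matrix (Basis n) (Basis n) ℂ) + (2 : ℂ) • skew v + -1 = (2 : ℂ) • skew v by abel,
    smul_smul]
  norm_num

/-! ### The action on Pauli words -/

/-- Conjugation by `u` carries the word `v` to a multiple of the word `w`. -/
def Act {n : ℕ} (u : U n) (v w : Word n) : Prop :=
  ∃ c : ℂ, u.1 * wordMatrix v = c • (wordMatrix w * u.1)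

theorem coe_mul_coe_inv {n : ℕ} (u : U n) : u.1 * u⁻¹.1 = 1 := by
  rw [← Submonoid.coe_mul, mul_inv_cancel, Submonoid.coe_one]

theorem coe_inv_mul_coe {n : ℕ} (u : U n) : u⁻¹.1 * u.1 = 1 := by
  rw [← Submonoid.coe_mul, inv_mul_cancel, Submonoid.coe_one]

theorem coe_ne_zero {n : ℕ} (u : U n) : u.1 ≠ 0 := by
  intro hu
  have := coe_mul_coe_inv u
  rw [hu, zero_mul] at this
  exact zero_ne_one this

theorem Act.mul {n : ℕ} {g k : U n} {v w x : Word n} (hk : Act k w x) (hg : Act g v w) :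
    Act (k * g) v x := by
  obtain ⟨c, hc⟩ := hg
  obtain ⟨d, hd⟩ := hk
  refine ⟨c * d, ?_⟩
  rw [Submonoid.coe_mul, mul_assoc, hc, mul_smul_comm, ← mul_assoc, hd, smul_mul_assoc, mul_assoc,
    smul_smul]

theorem Act.ne_zero {n : ℕ} {g : U n} {v w : Word n} {c : ℂ}
    (hc : g.1 * wordMatrix v = c • (wordMatrix w * g.1)) : c ≠ 0 := by
  rintro rfl
  rw [zero_smul, ← coe_word, ← Submonoid.coe_mul] at hc
  exact coe_ne_zero _ hc

theorem Act.inv {n : ℕ} {g : U n} {v w : Word n} (hg : Act g v w) : Act g⁻¹ w v := by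
  obtain ⟨c, hc⟩ := hg
  have h0 := Act.ne_zero hc
  refine ⟨c⁻¹, ?_⟩
  have h1 : g⁻¹.1 * (g.1 * wordMatrix v) * g⁻¹.1 = wordMatrix v * g⁻¹.1 := by
    rw [← mul_assoc, coe_inv_mul_coe, one_mul]
  rw [← h1, hc, mul_smul_comm, smul_mul_assoc, smul_smul, inv_mul_cancel₀ h0, one_smul, mul_assoc,
    mul_assoc, coe_mul_coe_inv, mul_one]

theorem Act.add {n : ℕ} {g : U n} {v w v' w' : Word n} (hg : Act g v w) (hg' : Act g v' w') :
    Act g (v + v') (w + w') := by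
  obtain ⟨c, hc⟩ := hg
  obtain ⟨d, hd⟩ := hg'
  have key : ∀ x y : Word n, wordMatrix (x + y) =
      sgn (x.2 ⬝ᵥ y.1) • (wordMatrix x * wordMatrix y) := by
    intro x y
    rw [wordMatrix_mul, smul_smul, sgn_mul_self, one_smul]
  refine ⟨sgn (v.2 ⬝ᵥ v'.1) * c * d * sgn (w.2 ⬝ᵥ w'.1), ?_⟩
  rw [key v, key w, mul_smul_comm, ← mul_assoc, hc, smul_mul_assoc, mul_assoc, hd, smul_mul_assoc,
    mul_smul_comm, smul_smul, smul_smul, smul_smul, ← mul_assoc,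
    mul_assoc _ (sgn (w.2 ⬝ᵥ w'.1)), sgn_mul_self, mul_one]

/-- Whether two operators commute or anticommute is unchanged by conjugation; the scalars picked up
by the two words cancel. -/
theorem Act.form_eq {n : ℕ} {g : U n} {v w v' w' : Word n} (hg : Act g v w) (hg' : Act g v' w') :
    form v v' = form w w' := by
  obtain ⟨c, hc⟩ := hg
  obtain ⟨d, hd⟩ := hg'
  have hc0 := Act.ne_zero hc
  have hd0 := Act.ne_zero hd
  have e1 : g.1 * (wordMatrix v * wordMatrix v') = (c * d) • (wordMatrix w * wordMatrix w' * g.1) := by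
    rw [← mul_assoc, hc, smul_mul_assoc, mul_assoc, hd, mul_smul_comm, smul_smul, mul_assoc]
  have e2 : g.1 * (wordMatrix v' * wordMatrix v) = (c * d) • (wordMatrix w' * wordMatrix w * g.1) := by
    rw [← mul_assoc, hd, smul_mul_assoc, mul_assoc, hc, mul_smul_comm, smul_smul, mul_assoc,
      mul_comm d]
  rw [wordMatrix_comm v v', mul_smul_comm, e2, wordMatrix_comm w w', smul_mul_assoc, smul_smul,
    smul_smul] at e1
  have hne : wordMatrix w' * wordMatrix w * g.1 ≠ 0 := by
    rw [← coe_word, ← coe_word, ← Submonoid.coe_mul, ← Submonoid.coe_mul]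
    exact coe_ne_zero _
  have := smul_left_injective ℂ hne e1
  exact sgn_injective (mul_right_cancel₀ (mul_ne_zero hc0 hd0) (this.trans (mul_comm _ _)))

theorem act_word {n : ℕ} (t v : Word n) : Act (word t) v v :=
  ⟨sgn (form t v), wordMatrix_comm t v⟩

theorem act_iff_skew {n : ℕ} {g : U n} {v w : Word n} :
    Act g v w ↔ ∃ c : ℂ, g.1 * skew v = c • (skew w * g.1) := by
  obtain ⟨c, hc0, hc, -⟩ := exists_skew v
  obtain ⟨d, hd0, hd, -⟩ := exists_skew w
  rw [hc, hd]
  constructor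
  · rintro ⟨k, hk⟩
    refine ⟨c * k * d⁻¹, ?_⟩
    rw [mul_smul_comm, hk, smul_mul_assoc, smul_smul, smul_smul, mul_assoc (c * k),
      inv_mul_cancel₀ hd0, mul_one]
  · rintro ⟨k, hk⟩
    refine ⟨c⁻¹ * k * d, ?_⟩
    rw [smul_mul_assoc, mul_smul_comm] at hk
    have := congrArg (fun A => c⁻¹ • A) hk
    simp only [smul_smul] at this
    rwa [inv_mul_cancel₀ hc0, one_smul, ← mul_assoc] at this

/-- Both skew operators have square `-1`, so the scalar between them has square `1`. Consequently
rotations are carried to rotations up to inversion only, which membership in a subgroup does not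
see. -/
theorem Act.skew_eq {n : ℕ} {g : U n} {v w : Word n} (hg : Act g v w) :
    g.1 * skew v = skew w * g.1 ∨ g.1 * skew v = -(skew w * g.1) := by
  obtain ⟨c, hc⟩ := act_iff_skew.mp hg
  have h1 : g.1 * (skew v * skew v) = (c * c) • (skew w * skew w * g.1) := by
    rw [← mul_assoc, hc, smul_mul_assoc, mul_assoc, hc, mul_smul_comm, smul_smul, mul_assoc]
  rw [skew_mul_self, skew_mul_self, neg_one_mul, mul_neg_one, smul_neg, neg_inj] at h1
  have h2 : (1 : ℂ) = c * c := smul_left_injective ℂ (coe_ne_zero g) (by simpa using h1)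
  rcases mul_self_eq_one_iff.mp h2.symm with rfl | rfl
  · left; simpa using hc
  · right; simpa using hc

theorem Act.conj_rot {n : ℕ} {g : U n} {v w : Word n} (hg : Act g v w) :
    g * rot v * g⁻¹ = rot w ∨ g * rot v * g⁻¹ = (rot w)⁻¹ := by
  refine hg.skew_eq.imp (fun hs => ?_) fun hs => ?_ <;>
  · rw [mul_inv_eq_iff_eq_mul]
    apply Subtype.ext
    rw [Submonoid.coe_mul, Submonoid.coe_mul, coe_rot]
    simp only [coe_rot, coe_rot_inv]
    rw [mul_smul_comm, smul_mul_assoc, mul_add, hs]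
    noncomm_ring

theorem act_rot_of_comm {n : ℕ} {t v : Word n} (htv : form t v = 0) : Act (rot t) v v := by
  refine act_iff_skew.mpr ⟨1, ?_⟩
  have := skew_comm t v
  rw [htv, sgn_zero, one_smul] at this
  rw [coe_rot, one_smul, smul_mul_assoc, mul_smul_comm, add_mul, mul_add, this, one_mul, mul_one]

/-- With `J`, `K` the skew operators of `t`, `v`, anticommutation gives `J K J = K`, hence `(1 + J)
K = J K (1 + J)`. Together with `act_rot_of_comm` this says that `rot t` acts as the transvection
with axis `t`. -/
theorem act_rot_of_anticomm {n : ℕ} {t v : Word n} (htv : form t v = 1) :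
    Act (rot t) v (t + v) := by
  have hm := skew_comm t v
  rw [htv, sgn_one, neg_one_smul] at hm
  have h1 : (1 + skew t) * skew v = skew t * skew v * (1 + skew t) := by
    have h2 : skew t * skew v * skew t = skew v := by
      rw [hm, neg_mul, mul_assoc, skew_mul_self, mul_neg_one, neg_neg]
    rw [mul_add, mul_one, h2, add_mul, one_mul, add_comm]
  obtain ⟨c, -, hc, -⟩ := exists_skew t
  obtain ⟨d, hd0, hd, -⟩ := exists_skew v
  have h3 : (rot t).1 * skew v = (c * d * sgn (t.2 ⬝ᵥ v.1)) • (wordMatrix (t + v) * (rot t).1) := by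
    rw [coe_rot, smul_mul_assoc, h1, mul_smul_comm, smul_comm, hc, hd, smul_mul_smul_comm,
      wordMatrix_mul]
    simp only [smul_mul_assoc, smul_smul]
  refine ⟨d⁻¹ * (c * d * sgn (t.2 ⬝ᵥ v.1)), ?_⟩
  rw [← smul_smul, ← h3, hd, mul_smul_comm, smul_smul, inv_mul_cancel₀ hd0, one_smul]

/-! ### Letters -/

/-- The word of `X_i`. -/
def xLetter {n : ℕ} (i : Fin n) : Word n := (Pi.single i 1, 0)

/-- The word of `Z_i`. -/
def zLetter {n : ℕ} (i : Fin n) : Word n := (0, Pi.single i 1)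

theorem form_zLetter_left {n : ℕ} (i : Fin n) (v : Word n) : form (zLetter i) v = v.1 i := by
  simp [form, zLetter]

theorem form_xLetter_left {n : ℕ} (i : Fin n) (v : Word n) : form (xLetter i) v = v.2 i := by
  simp [form, xLetter]

theorem form_zLetter_right {n : ℕ} (i : Fin n) (v : Word n) : form v (zLetter i) = v.1 i := by
  rw [form_comm, form_zLetter_left]

theorem form_xLetter_right {n : ℕ} (i : Fin n) (v : Word n) : form v (xLetter i) = v.2 i := by
  rw [form_comm, form_xLetter_left]

theorem fin_two_eq_zero_or_one (a : Fin 2) : a = 0 ∨ a = 1 := by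
  fin_cases a <;> simp

theorem word_induction {n : ℕ} {P : Word n → Prop} (h0 : P 0)
    (hadd : ∀ v w, P v → P w → P (v + w)) (hx : ∀ i, P (xLetter i)) (hz : ∀ i, P (zLetter i))
    (v : Word n) : P v := by
  have hv : v = ∑ i, ((if v.1 i = 1 then xLetter i else 0) +
      (if v.2 i = 1 then zLetter i else 0)) := by
    have key : ∀ (a : Basis n) (j : Fin n), a j = ∑ i, if a i = 1 then (Pi.single i 1 : Basis n) j
        else 0 := by
      intro a j
      rw [Finset.sum_eq_single j]
      · rcases fin_two_eq_zero_or_one (a j) with ha | ha <;> simp [ha]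
      · intro i _ hij
        simp [hij.symm]
      · simp
    ext j : 2
    · rw [Prod.fst_sum, Finset.sum_apply, key v.1 j]
      refine Finset.sum_congr rfl fun i _ => ?_
      rcases fin_two_eq_zero_or_one (v.1 i) with h1 | h1 <;>
        rcases fin_two_eq_zero_or_one (v.2 i) with h2 | h2 <;> simp [h1, h2, xLetter, zLetter]
    · rw [Prod.snd_sum, Finset.sum_apply, key v.2 j]
      refine Finset.sum_congr rfl fun i _ => ?_
      rcases fin_two_eq_zero_or_one (v.1 i) with h1 | h1 <;>
        rcases fin_two_eq_zero_or_one (v.2 i) with h2 | h2 <;> simp [h1, h2, xLetter, zLetter]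
  rw [hv]
  refine Finset.sum_induction _ P hadd h0 fun i _ => hadd _ _ ?_ ?_
  · split_ifs
    · exact hx i
    · exact h0
  · split_ifs
    · exact hz i
    · exact h0

/-! ### Operators fixing every letter -/

theorem Act.exists_sgn {n : ℕ} {g : U n} {v : Word n} (hg : Act g v v) :
    ∃ a, g.1 * wordMatrix v = sgn a • (wordMatrix v * g.1) := by
  obtain ⟨c, hc⟩ := hg
  have h1 : g.1 * (wordMatrix v * wordMatrix v) = (c * c) • (wordMatrix v * wordMatrix v * g.1) := by
    rw [← mul_assoc, hc, smul_mul_assoc, mul_assoc, hc, mul_smul_comm, smul_smul, mul_assoc]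
  rw [wordMatrix_mul_self, mul_smul_comm, mul_one, smul_mul_assoc, one_mul, smul_smul] at h1
  have h2 := smul_left_injective ℂ (coe_ne_zero g) h1
  have h3 : sgn (v.2 ⬝ᵥ v.1) ≠ 0 := by
    intro h0
    have := sgn_mul_self (v.2 ⬝ᵥ v.1)
    rw [h0, zero_mul] at this
    exact zero_ne_one this
  have h4 : c * c = 1 := mul_right_cancel₀ h3 (by rw [← h2, one_mul])
  rcases mul_self_eq_one_iff.mp h4 with rfl | rfl
  · exact ⟨0, by rw [hc, sgn_zero]⟩
  · exact ⟨1, by rw [hc, sgn_one]⟩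

/-- The letters generate all words. Commuting with the words `X^a` makes the diagonal constant, and
commuting with `Z_j` kills every entry whose two indices differ at `j`. -/
theorem eq_smul_one_of_commute {n : ℕ} {A : Matrix (Basis n) (Basis n) ℂ}
    (hx : ∀ i, Commute A (wordMatrix (xLetter i))) (hz : ∀ i, Commute A (wordMatrix (zLetter i))) :
    A = A 0 0 • (1 : Matrix (Basis n) (Basis n) ℂ) := by
  have all : ∀ v, Commute A (wordMatrix v) := by
    refine fun v => word_induction (P := fun v => Commute A (wordMatrix v)) ?_ ?_ hx hz v
    · rw [wordMatrix_zero]; exact Commute.one_right A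
    · intro v w hv hw
      have : wordMatrix (v + w) = sgn (v.2 ⬝ᵥ w.1) • (wordMatrix v * wordMatrix w) := by
        rw [wordMatrix_mul, smul_smul, sgn_mul_self, one_smul]
      rw [this]
      exact (hv.mul_right hw).smul_right _
  have entry : ∀ (v : Word n) (x y : Basis n), A x (y + v.1) * sgn (v.2 ⬝ᵥ y) = sgn (v.2 ⬝ᵥ (x + v.1)) * A (x + v.1) y := by
    intro v x y
    have := congrFun (congrFun (all v).eq x) y
    rw [Matrix.mul_apply, Matrix.mul_apply, Finset.sum_eq_single (y + v.1),
      Finset.sum_eq_single (x + v.1)] at this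
    · simpa [wordMatrix, add_assoc, basis_add_self] using this
    · intro z _ hz
      have : x ≠ z + v.1 := by
        rintro rfl
        exact hz (by rw [add_assoc, basis_add_self, add_zero])
      simp [wordMatrix, this]
    · simp
    · intro z _ hz
      simp [wordMatrix, hz]
    · simp
  ext x y
  rw [Matrix.smul_apply, smul_eq_mul, Matrix.one_apply]
  split_ifs with hxy
  · subst hxy
    have := entry (x, 0) x 0
    simpa [basis_add_self, sgn_zero] using this
  · obtain ⟨j, hj⟩ := Function.ne_iff.mp hxy
    have := entry (0, Pi.single j 1) x y
    simp only [add_zero, single_dotProduct, one_mul] at this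
    rw [mul_zero]
    by_contra hA
    rw [mul_comm] at this
    exact hj (sgn_injective (mul_right_cancel₀ hA this)).symm

/-- Conjugation by `u` changes `X_i` and `Z_i` by signs only. Since `form` is nondegenerate, some
word produces the same signs; dividing it out leaves an operator commuting with every letter. -/
theorem exists_word_mul_phase {n : ℕ} {u : U n} (hx : ∀ i, Act u (xLetter i) (xLetter i))
    (hz : ∀ i, Act u (zLetter i) (zLetter i)) : ∃ t, ∃ p ∈ phases n, u = word t * p := by
  choose b hb using fun i => (hx i).exists_sgn
  choose a ha using fun i => (hz i).exists_sgn
  have key : ∀ v, u.1 * wordMatrix v = sgn (form (a, b) v) • (wordMatrix v * u.1) →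
      Commute ((word (a, b))⁻¹ * u).1 (wordMatrix v) := by
    intro v hv
    have h1 : u.1 = wordMatrix (a, b) * ((word (a, b))⁻¹ * u).1 := by
      rw [← coe_word, ← Submonoid.coe_mul, mul_inv_cancel_left]
    have h2 : (word (a, b))⁻¹.1 * wordMatrix (a, b) = 1 := coe_inv_mul_coe _
    generalize ((word (a, b))⁻¹ * u).1 = p at h1
    rw [h1, ← mul_assoc (wordMatrix v), wordMatrix_comm v, smul_mul_assoc, smul_smul, form_comm v,
      sgn_mul_self, one_smul] at hv
    have h3 := congrArg (fun A => (word (a, b))⁻¹.1 * A) hv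
    simp only [← mul_assoc, h2, one_mul] at h3
    exact h3
  refine ⟨(a, b), (word (a, b))⁻¹ * u, ⟨_, eq_smul_one_of_commute (fun i => key _ ?_)
    fun i => key _ ?_⟩, by rw [mul_inv_cancel_left]⟩
  · rw [form_xLetter_right]; exact hb i
  · rw [form_zLetter_right]; exact ha i

/-! ### Moving words by rotations -/

/-- Some element of `N` fixes the words in `S` and carries `a` to `b`. -/
def Reach {n : ℕ} (N : Subgroup (U n)) (S : Set (Word n)) (a b : Word n) : Prop :=
  ∃ k ∈ N, (∀ v ∈ S, Act k v v) ∧ Act k a b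

theorem Reach.trans {n : ℕ} {N : Subgroup (U n)} {S : Set (Word n)} {a b c : Word n}
    (hab : Reach N S a b) (hbc : Reach N S b c) : Reach N S a c := by
  obtain ⟨k, hk, hkS, hkab⟩ := hab
  obtain ⟨l, hl, hlS, hlbc⟩ := hbc
  exact ⟨l * k, N.mul_mem hl hk, fun v hv => (hlS v hv).mul (hkS v hv), hlbc.mul hkab⟩

/-- The transvection with axis `a + b` sends `a` to `b`, and its axis commutes with `S` because `a`
and `b` pair equally with each word of `S`. -/
theorem reach_of_form_eq_one {n : ℕ} {N : Subgroup (U n)} {S : Set (Word n)}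
    (hN : ∀ t, (∀ v ∈ S, form v t = 0) → rot t ∈ N) {a b : Word n}
    (hS : ∀ v ∈ S, form v a = form v b) (hab : form a b = 1) : Reach N S a b := by
  have hS' : ∀ v ∈ S, form v (a + b) = 0 := fun v hv => by
    rw [form_add_right, hS v hv, fin_two_add_self]
  refine ⟨rot (a + b), hN _ hS', fun v hv => act_rot_of_comm ?_, ?_⟩
  · rw [form_comm]; exact hS' v hv
  · have := act_rot_of_anticomm (t := a + b) (v := a)
      (by rw [form_add_left, form_self, zero_add, form_comm, hab])
    rwa [add_comm (a + b), word_add_cancel] at this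

/-- With `e'`, `f'` the images of `e`, `f`, two transvections bring `e'` back to `e` through a word
that commutes with `S` and anticommutes with both. One of `f'`, `f`, `f + f'` is such a word. -/
theorem exists_fix_left {n : ℕ} {N : Subgroup (U n)} {S : Set (Word n)}
    (hN : ∀ t, (∀ v ∈ S, form v t = 0) → rot t ∈ N) {u : U n} (hu : ∀ v, ∃ w, Act u v w)
    (hS : ∀ v ∈ S, Act u v v) {e f : Word n} (he : ∀ v ∈ S, form v e = 0)
    (hf : ∀ v ∈ S, form v f = 0) (hef : form e f = 1) :
    ∃ k ∈ N, (∀ v ∈ S, Act (k * u) v v) ∧ Act (k * u) e e := by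
  obtain ⟨e', he'⟩ := hu e
  obtain ⟨f', hf'⟩ := hu f
  have hSe : ∀ v ∈ S, form v e' = 0 := fun v hv => by rw [← (hS v hv).form_eq he', he v hv]
  have hSf : ∀ v ∈ S, form v f' = 0 := fun v hv => by rw [← (hS v hv).form_eq hf', hf v hv]
  have hef' : form e' f' = 1 := by rw [← he'.form_eq hf', hef]
  have via : ∀ w, (∀ v ∈ S, form v w = 0) → form e' w = 1 → form e w = 1 → Reach N S e' e :=
    fun w hw h1 h2 => (reach_of_form_eq_one hN (fun v hv => by rw [hSe v hv, hw v hv]) h1).trans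
      (reach_of_form_eq_one hN (fun v hv => by rw [he v hv, hw v hv]) (by rw [form_comm, h2]))
  have hr : Reach N S e' e := by
    rcases fin_two_eq_zero_or_one (form e f') with h1 | h1
    · rcases fin_two_eq_zero_or_one (form e' f) with h2 | h2
      · exact via (f + f') (fun v hv => by rw [form_add_right, hf v hv, hSf v hv, add_zero])
          (by rw [form_add_right, h2, hef', zero_add]) (by rw [form_add_right, h1, hef, add_zero])
      · exact via f hf h2 hef
    · exact via f' hSf hef' h1
  obtain ⟨k, hk, hkS, hke⟩ := hr
  exact ⟨k, hk, fun v hv => (hkS v hv).mul (hS v hv), hke.mul he'⟩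

/-- The partner `f` of a fixed `e` is restored without disturbing `e`. If the image `f'`
anticommutes with `f`, one transvection suffices; otherwise `e + f` anticommutes with both and
serves as an intermediate stop. -/
theorem exists_fix_right {n : ℕ} {N : Subgroup (U n)} {S : Set (Word n)} {e f : Word n}
    (hN : ∀ t, (∀ v ∈ insert e S, form v t = 0) → rot t ∈ N) {u : U n}
    (hu : ∀ v, ∃ w, Act u v w) (hS : ∀ v ∈ insert e S, Act u v v) (he : ∀ v ∈ S, form v e = 0)
    (hef : form e f = 1) :
    ∃ k ∈ N, (∀ v ∈ insert e S, Act (k * u) v v) ∧ Act (k * u) f f := by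
  obtain ⟨f', hf'⟩ := hu f
  have hSf : ∀ v ∈ insert e S, form v f' = form v f := fun v hv => ((hS v hv).form_eq hf').symm
  have hee : ∀ v ∈ insert e S, form v e = 0 := by
    rintro v (rfl | hv)
    · exact form_self v
    · exact he v hv
  have hef' : form e f' = 1 := by rw [hSf e (Set.mem_insert _ _), hef]
  have hr : Reach N (insert e S) f' f := by
    rcases fin_two_eq_zero_or_one (form f f') with h1 | h1
    · have hadd : ∀ v ∈ insert e S, form v (e + f) = form v f := fun v hv => by
        rw [form_add_right, hee v hv, zero_add]
      refine (reach_of_form_eq_one hN (b := e + f) (fun v hv => by rw [hSf v hv, hadd v hv])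
        ?_).trans (reach_of_form_eq_one hN hadd ?_)
      · rw [form_add_right, form_comm, hef', form_comm, h1, add_zero]
      · rw [form_add_left, hef, form_self, add_zero]
    · exact reach_of_form_eq_one hN hSf (by rw [form_comm, h1])
  obtain ⟨k, hk, hkS, hke⟩ := hr
  exact ⟨k, hk, fun v hv => (hkS v hv).mul (hS v hv), hke.mul hf'⟩

/-! ### Sweeping -/

theorem form_xLetter_xLetter {n : ℕ} (i j : Fin n) : form (xLetter i) (xLetter j) = 0 := by
  rw [form_xLetter_left]; rfl

theorem form_zLetter_zLetter {n : ℕ} (i j : Fin n) : form (zLetter i) (zLetter j) = 0 := by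
  rw [form_zLetter_left]; rfl

theorem form_zLetter_xLetter_self {n : ℕ} (i : Fin n) : form (zLetter i) (xLetter i) = 1 := by
  rw [form_zLetter_left]; simp [xLetter]

theorem form_zLetter_xLetter_of_ne {n : ℕ} {i j : Fin n} (hij : i ≠ j) :
    form (zLetter i) (xLetter j) = 0 := by
  rw [form_zLetter_left]; simp [xLetter, hij]

/-- The letters of the first `k` qubits. -/
def letters (n k : ℕ) : Set (Word n) :=
  {v | ∃ j : Fin n, j.val < k ∧ (v = zLetter j ∨ v = xLetter j)}

theorem form_letters {n k : ℕ} {j : Fin n} (hj : k ≤ j.val) {v : Word n} (hv : v ∈ letters n k) :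
    form v (zLetter j) = 0 ∧ form v (xLetter j) = 0 := by
  obtain ⟨i, hi, rfl | rfl⟩ := hv
  · exact ⟨form_zLetter_zLetter i j, form_zLetter_xLetter_of_ne (by rintro rfl; omega)⟩
  · refine ⟨?_, form_xLetter_xLetter i j⟩
    rw [form_comm, form_zLetter_xLetter_of_ne (by rintro rfl; omega)]

theorem exists_fix_letters {n : ℕ} {N : Subgroup (U n)} (hn : 0 < n)
    (hact : ∀ k ∈ N, ∀ v, ∃ w, Act k v w)
    (hN : ∀ t, form (zLetter ⟨0, hn⟩) t = 0 → rot t ∈ N) {u : U n} (hu : ∀ v, ∃ w, Act u v w)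
    (hz : Act u (zLetter ⟨0, hn⟩) (zLetter ⟨0, hn⟩)) :
    ∀ k, 1 ≤ k → k ≤ n → ∃ g ∈ N, ∀ v ∈ letters n k, Act (g * u) v v := by
  intro k hk
  have hact' : ∀ g ∈ N, ∀ v, ∃ w, Act (g * u) v w := by
    intro g hg v
    obtain ⟨w, hw⟩ := hu v
    obtain ⟨x, hx⟩ := hact g hg w
    exact ⟨x, hx.mul hw⟩
  induction k, hk using Nat.le_induction with
  | base =>
    intro _
    -- On the first qubit `Z` is fixed by assumption, so only its partner `X` has to be restored.
    obtain ⟨g, hg, hgS, hgf⟩ := exists_fix_right (N := N) (S := ∅) (u := u)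
      (e := zLetter ⟨0, hn⟩) (f := xLetter ⟨0, hn⟩) (fun t ht => hN t (ht _ (by simp))) hu
      (by simpa using hz) (by simp) (form_zLetter_xLetter_self _)
    refine ⟨g, hg, ?_⟩
    rintro v ⟨⟨j, hjn⟩, hj, hv⟩
    obtain rfl : j = 0 := by simpa using hj
    rcases hv with rfl | rfl
    · exact hgS _ (by simp)
    · exact hgf
  | succ k hk ih =>
    intro hkn
    obtain ⟨g, hg, hgS⟩ := ih (by omega)
    have h0 : zLetter ⟨0, hn⟩ ∈ letters n k := ⟨⟨0, hn⟩, hk, Or.inl rfl⟩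
    obtain ⟨a, ha, haS, hae⟩ := exists_fix_left (N := N) (S := letters n k) (u := g * u)
      (e := zLetter ⟨k, hkn⟩) (f := xLetter ⟨k, hkn⟩) (fun t ht => hN t (ht _ h0)) (hact' g hg) hgS
      (fun v hv => (form_letters le_rfl hv).1) (fun v hv => (form_letters le_rfl hv).2)
      (form_zLetter_xLetter_self _)
    rw [← mul_assoc] at hae
    simp only [← mul_assoc] at haS
    obtain ⟨b, hb, hbS, hbf⟩ := exists_fix_right (N := N) (S := letters n k) (u := a * g * u)
      (e := zLetter ⟨k, hkn⟩) (f := xLetter ⟨k, hkn⟩)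
      (fun t ht => hN t (ht _ (Set.mem_insert_of_mem _ h0))) (hact' _ (N.mul_mem ha hg))
      (by
        rintro v (rfl | hv)
        · exact hae
        · exact haS v hv)
      (fun v hv => (form_letters le_rfl hv).1)
      (form_zLetter_xLetter_self _)
    rw [← mul_assoc] at hbf
    simp only [← mul_assoc] at hbS
    refine ⟨b * a * g, N.mul_mem (N.mul_mem hb ha) hg, ?_⟩
    simp only [mul_assoc] at hbS hbf ⊢
    rintro v ⟨⟨j, hjn⟩, hj, hv⟩
    rcases Nat.lt_succ_iff_lt_or_eq.mp hj with hj | rfl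
    · exact hbS v (Set.mem_insert_of_mem _ ⟨_, hj, hv⟩)
    · rcases hv with rfl | rfl
      · exact hbS _ (Set.mem_insert _ _)
      · exact hbf

/-! ### Membership modulo phases -/

theorem mul_mem_phases_iff {n : ℕ} {N : Subgroup (U n)} (hN : phases n ≤ N) {a b : U n} {c : ℂ}
    (hab : a.1 = c • b.1) : a ∈ N ↔ b ∈ N := by
  have hp : a * b⁻¹ ∈ phases n := ⟨c, by
    rw [Submonoid.coe_mul, hab, smul_mul_assoc, coe_mul_coe_inv]⟩
  have h1 : a = a * b⁻¹ * b := by group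
  rw [h1, N.mul_mem_cancel_left (hN hp)]

theorem word_mem_of_rot_mem {n : ℕ} {N : Subgroup (U n)} (hN : phases n ≤ N) {v : Word n}
    (hv : rot v ∈ N) : word v ∈ N := by
  obtain ⟨c, -, hc, -⟩ := exists_skew v
  have h1 : (rot v * rot v).1 = c • (word v).1 := by rw [rot_mul_self, hc]; rfl
  exact (mul_mem_phases_iff hN h1).mp (N.mul_mem hv hv)

theorem word_add_mem {n : ℕ} {N : Subgroup (U n)} (hN : phases n ≤ N) {v w : Word n}
    (hv : word v ∈ N) (hw : word w ∈ N) : word (v + w) ∈ N := by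
  have h1 : (word v * word w).1 = sgn (v.2 ⬝ᵥ w.1) • (word (v + w)).1 := wordMatrix_mul v w
  exact (mul_mem_phases_iff hN h1).mp (N.mul_mem hv hw)

/-- After all letters have been restored, a Pauli word remains up to a phase. If it commutes with
`Z₁` it is the square of a rotation in `N`, up to a phase; otherwise it does so after removal of
`X₁`. -/
theorem mem_of_act_zLetter {n : ℕ} {N : Subgroup (U n)} (hn : 0 < n) (hp : phases n ≤ N)
    (hact : ∀ k ∈ N, ∀ v, ∃ w, Act k v w)
    (hN : ∀ t, form (zLetter ⟨0, hn⟩) t = 0 → rot t ∈ N) (hx : word (xLetter ⟨0, hn⟩) ∈ N)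
    {u : U n} (hu : ∀ v, ∃ w, Act u v w) (hz : Act u (zLetter ⟨0, hn⟩) (zLetter ⟨0, hn⟩)) :
    u ∈ N := by
  obtain ⟨g, hg, hfix⟩ := exists_fix_letters hn hact hN hu hz n hn le_rfl
  obtain ⟨t, p, hp', hgu⟩ := exists_word_mul_phase (u := g * u)
    (fun i => hfix _ ⟨i, i.isLt, Or.inr rfl⟩) (fun i => hfix _ ⟨i, i.isLt, Or.inl rfl⟩)
  have ht : word t ∈ N := by
    rcases fin_two_eq_zero_or_one (form (zLetter ⟨0, hn⟩) t) with h1 | h1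
    · exact word_mem_of_rot_mem hp (hN t h1)
    · rw [← word_add_cancel (xLetter ⟨0, hn⟩) t]
      refine word_add_mem hp hx (word_mem_of_rot_mem hp (hN _ ?_))
      rw [form_add_right, form_zLetter_xLetter_self, h1, fin_two_add_self]
  rw [← N.mul_mem_cancel_left hg, hgu]
  exact N.mul_mem ht (hp hp')

/-! ### Generating all rotations about words commuting with the first `Z` -/

theorem rot_add_mem {n : ℕ} {N : Subgroup (U n)} {v w : Word n} (hvw : form v w = 1)
    (hv : rot v ∈ N) (hw : rot w ∈ N) : rot (v + w) ∈ N := by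
  have h1 : rot v * rot w * (rot v)⁻¹ ∈ N := N.mul_mem (N.mul_mem hv hw) (N.inv_mem hv)
  rcases (act_rot_of_anticomm hvw).conj_rot with h2 | h2 <;> rw [h2] at h1
  · exact h1
  · exact inv_mem_iff.mp h1

/-- The word `v` involves only the first `k` qubits. -/
def SupportedBelow {n : ℕ} (k : ℕ) (v : Word n) : Prop :=
  ∀ i : Fin n, k ≤ i.val → v.1 i = 0 ∧ v.2 i = 0

/-- The three nontrivial Pauli words on qubit `k`. -/
def qubitWords {n : ℕ} (k : Fin n) : Set (Word n) :=
  {xLetter k, zLetter k, xLetter k + zLetter k}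

theorem SupportedBelow.add {n k : ℕ} {v w : Word n} (hv : SupportedBelow k v)
    (hw : SupportedBelow k w) : SupportedBelow k (v + w) := fun i hi =>
  ⟨by rw [Prod.fst_add, Pi.add_apply, (hv i hi).1, (hw i hi).1, add_zero],
    by rw [Prod.snd_add, Pi.add_apply, (hv i hi).2, (hw i hi).2, add_zero]⟩

theorem supportedBelow_xLetter {n k : ℕ} {i : Fin n} (hi : i.val < k) :
    SupportedBelow k (xLetter i) := fun j hj => by
  have : j ≠ i := by rintro rfl; omega
  simp [xLetter, this]

theorem supportedBelow_zLetter {n k : ℕ} {i : Fin n} (hi : i.val < k) :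
    SupportedBelow k (zLetter i) := fun j hj => by
  have : j ≠ i := by rintro rfl; omega
  simp [zLetter, this]

theorem SupportedBelow.form_eq_zero {n : ℕ} {k : Fin n} {v p : Word n} (hv : SupportedBelow k.val v)
    (hp : p ∈ qubitWords k) : form v p = 0 := by
  have h1 : form v (xLetter k) = 0 := by rw [form_xLetter_right]; exact (hv k le_rfl).2
  have h2 : form v (zLetter k) = 0 := by rw [form_zLetter_right]; exact (hv k le_rfl).1
  rcases hp with rfl | rfl | rfl
  · exact h1
  · exact h2
  · rw [form_add_right, h1, h2, add_zero]

theorem SupportedBelow.exists_eq_add {n : ℕ} {k : Fin n} {v : Word n}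
    (hv : SupportedBelow (k.val + 1) v) : SupportedBelow k.val v ∨
      ∃ u, SupportedBelow k.val u ∧ ∃ p ∈ qubitWords k, v = u + p := by
  have key : ∀ p ∈ qubitWords k, v.1 k = p.1 k → v.2 k = p.2 k →
      ∃ u, SupportedBelow k.val u ∧ ∃ p ∈ qubitWords k, v = u + p := by
    intro p hp h1 h2
    refine ⟨p + v, ?_, p, hp, by rw [add_comm, word_add_cancel]⟩
    intro i hi
    rcases hi.lt_or_eq with hi | hi
    · have hp' : SupportedBelow (k.val + 1) p := by
        rcases hp with rfl | rfl | rfl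
        · exact supportedBelow_xLetter (Nat.lt_succ_self _)
        · exact supportedBelow_zLetter (Nat.lt_succ_self _)
        · exact (supportedBelow_xLetter (Nat.lt_succ_self _)).add
            (supportedBelow_zLetter (Nat.lt_succ_self _))
      exact (hp'.add hv) i hi
    · obtain rfl : k = i := Fin.ext hi
      rw [Prod.fst_add, Prod.snd_add, Pi.add_apply, Pi.add_apply, h1, h2, fin_two_add_self,
        fin_two_add_self]
      exact ⟨rfl, rfl⟩
  rcases fin_two_eq_zero_or_one (v.1 k) with h1 | h1 <;>
    rcases fin_two_eq_zero_or_one (v.2 k) with h2 | h2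
  · left
    intro i hi
    rcases hi.lt_or_eq with hi | hi
    · exact hv i hi
    · obtain rfl : k = i := Fin.ext hi
      exact ⟨h1, h2⟩
  all_goals right
  · exact key (zLetter k) (by simp [qubitWords]) (by simp [h1, zLetter]) (by simp [h2, zLetter])
  · exact key (xLetter k) (by simp [qubitWords]) (by simp [h1, xLetter]) (by simp [h2, xLetter])
  · exact key (xLetter k + zLetter k) (by simp [qubitWords]) (by simp [h1, xLetter, zLetter])
      (by simp [h2, xLetter, zLetter])

theorem exists_qubitWords_add {n : ℕ} {k : Fin n} {p : Word n} (hp : p ∈ qubitWords k) :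
    ∃ q ∈ qubitWords k, ∃ r ∈ qubitWords k, p = q + r ∧ form q r = 1 := by
  have hzx := form_zLetter_xLetter_self k
  rcases hp with rfl | rfl | rfl
  · refine ⟨zLetter k, by simp [qubitWords], xLetter k + zLetter k, by simp [qubitWords], ?_, ?_⟩
    · rw [add_comm (xLetter k), word_add_cancel]
    · rw [form_add_right, hzx, form_self, add_zero]
  · refine ⟨xLetter k, by simp [qubitWords], xLetter k + zLetter k, by simp [qubitWords], ?_, ?_⟩
    · rw [word_add_cancel]
    · rw [form_add_right, form_self, form_comm, hzx, zero_add]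
  · exact ⟨xLetter k, by simp [qubitWords], zLetter k, by simp [qubitWords], rfl,
      by rw [form_comm, hzx]⟩

/-- Induction on the last qubit of the support, splitting `v` as `u + p` with `p` a nontrivial word
on that qubit. The exception `Z₁` is unavoidable: it commutes with all words considered, so two of
them with sum `Z₁` commute with each other. -/
theorem mem_of_closed {n : ℕ} (hn : 0 < n) {T : Set (Word n)} (h0 : 0 ∈ T)
    (hadd : ∀ v w, form v w = 1 → v ∈ T → w ∈ T → v + w ∈ T)
    (hx : ∀ i : Fin n, 1 ≤ i.val → xLetter i ∈ T) (hz : ∀ i : Fin n, 1 ≤ i.val → zLetter i ∈ T)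
    (hzx : ∀ (k : ℕ) (hk : k + 1 < n),
      zLetter (⟨k, by omega⟩ : Fin n) + xLetter ⟨k + 1, hk⟩ ∈ T)
    {v : Word n} (hv : form (zLetter ⟨0, hn⟩) v = 0) (hne : v ≠ zLetter ⟨0, hn⟩) : v ∈ T := by
  have hq : ∀ i : Fin n, 1 ≤ i.val → ∀ p ∈ qubitWords i, p ∈ T := by
    rintro i hi p (rfl | rfl | rfl)
    · exact hx i hi
    · exact hz i hi
    · exact hadd _ _ (by rw [form_comm, form_zLetter_xLetter_self]) (hx i hi) (hz i hi)
  -- Starting from `Z_k X_{k+1}`, adding `Z_{k+1}` and then `X_{k+1}` runs through all three words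
  -- on the next qubit; each addition involves an anticommuting pair.
  have hzq : ∀ (k : ℕ) (hk : k + 1 < n), ∀ p ∈ qubitWords (⟨k + 1, hk⟩ : Fin n),
      zLetter (⟨k, by omega⟩ : Fin n) + p ∈ T := by
    intro k hk p hp
    have hxz := form_zLetter_xLetter_self (⟨k + 1, hk⟩ : Fin n)
    have hzz := form_zLetter_zLetter (⟨k, by omega⟩ : Fin n) ⟨k + 1, hk⟩
    have h0x : form (zLetter (⟨k, by omega⟩ : Fin n)) (xLetter ⟨k + 1, hk⟩) = 0 :=
      form_zLetter_xLetter_of_ne (by simp [Fin.ext_iff])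
    have hy : zLetter (⟨k, by omega⟩ : Fin n) + (xLetter ⟨k + 1, hk⟩ + zLetter ⟨k + 1, hk⟩) ∈ T := by
      rw [← add_assoc]
      refine hadd _ _ ?_ (hzx k hk) (hz _ (by simp))
      rw [form_add_left, hzz, form_comm, hxz, zero_add]
    rcases hp with rfl | rfl | rfl
    · exact hzx k hk
    · have := hadd _ _ ?_ hy (hx ⟨k + 1, hk⟩ (by simp))
      · rwa [add_assoc, add_comm (xLetter _) (zLetter _), add_assoc, word_add_self,
          add_zero] at this
      · rw [form_add_left, form_add_left, h0x, hxz, form_self, zero_add, zero_add]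
    · exact hy
  have main : ∀ k, k ≤ n → ∀ v, SupportedBelow k v → form (zLetter ⟨0, hn⟩) v = 0 →
      v ≠ zLetter ⟨0, hn⟩ → v ∈ T := by
    intro k
    induction k with
    | zero =>
      intro _ v hv _ _
      have : v = 0 := by
        ext i : 2
        · exact (hv i (Nat.zero_le _)).1
        · exact (hv i (Nat.zero_le _)).2
      rw [this]; exact h0
    | succ k ih =>
      intro hk v hsupp hv hne
      have hsupp' : SupportedBelow ((⟨k, hk⟩ : Fin n).val + 1) v := hsupp
      rcases hsupp'.exists_eq_add with hlow | ⟨u, hu, p, hp, rfl⟩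
      · exact ih (by omega) v hlow hv hne
      rcases k with _ | j
      -- On the first qubit alone, the only nontrivial word commuting with `Z₁` is `Z₁` itself,
      -- which is excluded.
      · exfalso
        have hu0 : u = 0 := by
          ext i : 2
          · exact (hu i (Nat.zero_le _)).1
          · exact (hu i (Nat.zero_le _)).2
        rw [hu0, zero_add] at hv hne
        rcases hp with rfl | rfl | rfl
        · rw [form_zLetter_xLetter_self] at hv; simp at hv
        · exact hne rfl
        · rw [form_add_right, form_zLetter_xLetter_self, form_self] at hv; simp at hv
      have hu : SupportedBelow (j + 1) u := hu
      have hlt : j < n := by omega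
      have hz0 : SupportedBelow (j + 1) (zLetter (⟨0, hn⟩ : Fin n)) :=
        supportedBelow_zLetter (Nat.succ_pos j)
      have h0p : ∀ q ∈ qubitWords (⟨j + 1, hk⟩ : Fin n), form (zLetter ⟨0, hn⟩) q = 0 :=
        fun q hq => SupportedBelow.form_eq_zero hz0 hq
      rw [form_add_right, h0p p hp, add_zero] at hv
      rcases j with _ | j
      -- Here `u` lives on the first qubit and commutes with `Z₁`, so it is `0` or `Z₁`.
      · have h1 : u.2 ⟨0, hn⟩ = 0 ∨ u.2 ⟨0, hn⟩ = 1 := fin_two_eq_zero_or_one _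
        rw [form_zLetter_left] at hv
        rcases h1 with h1 | h1
        · have : u = 0 := by
            ext i : 2
            all_goals
              rcases Nat.eq_zero_or_pos i.val with hi | hi
              · obtain rfl : i = ⟨0, hn⟩ := Fin.ext hi
                assumption
              · first
                | exact (hu i hi).1
                | exact (hu i hi).2
          rw [this, zero_add]
          exact hq _ (by simp) p hp
        · have : u = zLetter ⟨0, hn⟩ := by
            ext i : 2
            · rcases Nat.eq_zero_or_pos i.val with hi | hi
              · obtain rfl : i = ⟨0, hn⟩ := Fin.ext hi
                exact hv
              · exact (hu i hi).1
            · rcases Nat.eq_zero_or_pos i.val with hi | hi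
              · obtain rfl : i = ⟨0, hn⟩ := Fin.ext hi
                simpa [zLetter] using h1
              · rw [(hu i hi).2]
                have : i ≠ ⟨0, hn⟩ := by rintro rfl; simp at hi
                simp [zLetter, this]
          rw [this]
          exact hzq 0 hk p hp
      · set z : Word n := zLetter ⟨j + 1, hlt⟩ with hzdef
        set x : Word n := xLetter ⟨j + 1, hlt⟩ with hxdef
        have hzs : SupportedBelow (j + 1 + 1) z := supportedBelow_zLetter (Nat.lt_succ_self _)
        have hxs : SupportedBelow (j + 1 + 1) x := supportedBelow_xLetter (Nat.lt_succ_self _)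
        have h0z : form (zLetter ⟨0, hn⟩) z = 0 := form_zLetter_zLetter _ _
        have h0x : form (zLetter ⟨0, hn⟩) x = 0 :=
          form_zLetter_xLetter_of_ne (by simp [Fin.ext_iff])
        have hxz : form x z = 1 := by rw [form_comm]; exact form_zLetter_xLetter_self _
        -- If `u` anticommutes with `z`, then `u + p` is the sum of the anticommuting words `u + z`
        -- and `z + p`. The first is known by induction; it is not `Z₁` because it anticommutes with
        -- `z`.
        have step1 : ∀ u, SupportedBelow (j + 1 + 1) u → form (zLetter ⟨0, hn⟩) u = 0 →
            form u z = 1 → ∀ p ∈ qubitWords (⟨j + 1 + 1, hk⟩ : Fin n), u + p ∈ T := by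
          intro u hu h0u huz p hp
          have h1 : u + z ∈ T := by
            refine ih (by omega) _ (hu.add hzs) (by rw [form_add_right, h0u, h0z, add_zero]) ?_
            intro he
            have h2 : form (u + z) z = 1 := by rw [form_add_left, huz, form_self, add_zero]
            rw [he, h0z] at h2
            simp at h2
          have h2 := hadd _ _ ?_ h1 (hzq (j + 1) hk p hp)
          · rwa [add_assoc, word_add_cancel] at h2
          · rw [form_add_left, form_add_right, form_add_right, huz, form_self,
              SupportedBelow.form_eq_zero (k := ⟨j + 1 + 1, hk⟩) hu hp,
              SupportedBelow.form_eq_zero (k := ⟨j + 1 + 1, hk⟩) hzs hp]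
            rfl
        rcases fin_two_eq_zero_or_one (form u z) with huz | huz
        -- When `u` commutes with `z`, the word `u + x` does not, so `step1` applies to it; the
        -- extra `x` must then be removed.
        · have hux : ∀ q ∈ qubitWords (⟨j + 1 + 1, hk⟩ : Fin n), u + x + q ∈ T :=
            step1 (u + x) (hu.add hxs) (by rw [form_add_right, hv, h0x, add_zero])
              (by rw [form_add_left, huz, hxz, zero_add])
          rcases fin_two_eq_zero_or_one (form u x) with hux' | hux'
          -- Here `x` cannot be removed directly, as it commutes with `u`. Splitting `p` into an
          -- anticommuting pair `q + r` makes `u + x + q` and `x + r` anticommute, and the two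
          -- copies of `x` cancel.
          · obtain ⟨q, hq, r, hr, rfl, hqr⟩ := exists_qubitWords_add hp
            have h1 := hadd _ _ ?_ (hux q hq) (step1 x hxs h0x hxz r hr)
            · convert h1 using 1
              rw [show u + x + q + (x + r) = u + (q + r) + (x + x) by abel, word_add_self,
                add_zero]
            · rw [form_add_left, form_add_left, form_add_right, form_add_right, form_add_right,
                hqr, hux', form_self, form_comm q x,
                SupportedBelow.form_eq_zero (k := ⟨j + 1 + 1, hk⟩) hu hr,
                SupportedBelow.form_eq_zero (k := ⟨j + 1 + 1, hk⟩) hxs hr,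
                SupportedBelow.form_eq_zero (k := ⟨j + 1 + 1, hk⟩) hxs hq]
              rfl
          · have h1 := hadd _ _ ?_ (hux p hp) (hx ⟨j + 1, hlt⟩ (by simp))
            · convert h1 using 1
              rw [← hxdef, show u + x + p + x = u + p + (x + x) by abel, word_add_self, add_zero]
            · rw [← hxdef, form_add_left, form_add_left, hux', form_self, form_comm,
                SupportedBelow.form_eq_zero (k := ⟨j + 1 + 1, hk⟩) hxs hp]
              rfl
        · exact step1 u hu hv huz p hp
  exact main n le_rfl v (fun i hi => absurd i.isLt (by omega)) hv hne

theorem rot_zero_mem_phases {n : ℕ} : rot (0 : Word n) ∈ phases n := by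
  obtain ⟨c, -, hc, -⟩ := exists_skew (0 : Word n)
  refine ⟨((√2 : ℝ) : ℂ)⁻¹ * (1 + c), ?_⟩
  rw [coe_rot, hc, wordMatrix_zero, ← smul_smul, add_smul, one_smul]

theorem rot_mem_of_generators {n : ℕ} (hn : 0 < n) {N : Subgroup (U n)} (hp : phases n ≤ N)
    (hx : ∀ i : Fin n, 1 ≤ i.val → rot (xLetter i) ∈ N)
    (hz : ∀ i : Fin n, 1 ≤ i.val → rot (zLetter i) ∈ N)
    (hzx : ∀ (k : ℕ) (hk : k + 1 < n),
      rot (zLetter (⟨k, by omega⟩ : Fin n) + xLetter ⟨k + 1, hk⟩) ∈ N)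
    {v : Word n} (hv : form (zLetter ⟨0, hn⟩) v = 0) (hne : v ≠ zLetter ⟨0, hn⟩) : rot v ∈ N :=
  mem_of_closed hn (T := {v | rot v ∈ N}) (hp rot_zero_mem_phases)
    (fun _ _ h1 h2 h3 => rot_add_mem h1 h2 h3) hx hz hzx hv hne

/-! ### Relations between diagonal rotations -/

/-- The diagonal of the rotation about `Z^b`, up to scale. -/
def phaseVal {n : ℕ} (b x : Basis n) : ℂ := 1 + Complex.I * sgn (b ⬝ᵥ x)

theorem coe_rot_diagonal {n : ℕ} (b : Basis n) :
    (rot ((0, b) : Word n)).1 = ((√2 : ℝ) : ℂ)⁻¹ • Matrix.diagonal (phaseVal b) := by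
  rw [coe_rot]
  congr 1
  ext x y
  by_cases hxy : x = y
  · subst hxy; simp [skew, wordMatrix, phaseVal]
  · simp [skew, wordMatrix, hxy]

theorem sgn_eq_one_or {a : Fin 2} : sgn a = 1 ∨ sgn a = -1 := by
  rcases fin_two_eq_zero_or_one a with rfl | rfl
  · exact Or.inl sgn_zero
  · exact Or.inr sgn_one

/-- This relation recovers `rot Z₁`, and with it `s₁`, from a controlled `Z` gate and the rotations
about `Z₂` and `Z₁Z₂`. -/
theorem rot_mul_rot_diagonal {n : ℕ} {i j : Fin n} :
    ∃ c : ℂ, (rot (zLetter i) * rot (zLetter j)).1 =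
      c • (gateCZ i j * rot (zLetter i + zLetter j)).1 := by
  -- The scalar is read off from the diagonal entry at the zero basis vector, where every sign is
  -- `1`.
  refine ⟨((√2 : ℝ) : ℂ)⁻¹ * (1 + Complex.I), ?_⟩
  have hadd : zLetter i + zLetter j = (0, (Pi.single i 1 + Pi.single j 1 : Basis n)) := by
    simp [zLetter]
  rw [hadd, Submonoid.coe_mul, Submonoid.coe_mul, zLetter, zLetter, coe_rot_diagonal,
    coe_rot_diagonal, coe_rot_diagonal, gateCZ, smul_mul_smul_comm, Matrix.mul_smul,
    Matrix.diagonal_mul_diagonal, Matrix.diagonal_mul_diagonal, smul_smul,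
    ← Matrix.diagonal_smul, ← Matrix.diagonal_smul]
  refine congrArg Matrix.diagonal (funext fun x => ?_)
  simp only [phaseVal, add_dotProduct, single_dotProduct, one_mul, sgn_add, Pi.smul_apply,
    smul_eq_mul]
  have key : (1 + Complex.I * sgn (x i)) * (1 + Complex.I * sgn (x j)) = (1 + Complex.I) *
      ((if x i = 1 ∧ x j = 1 then -1 else 1) * (1 + Complex.I * (sgn (x i) * sgn (x j)))) := by
    rcases fin_two_eq_zero_or_one (x i) with h1 | h1 <;>
      rcases fin_two_eq_zero_or_one (x j) with h2 | h2 <;>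
      rw [h1, h2] <;> apply Complex.ext <;> simp [sgn]
  rw [key]
  ring

/-- An identity of diagonal matrices, checked on the eight sign patterns. For three independent `a`,
`b`, `d` it expresses the rotation about `Z^a` through the six others, without any controlled gate.
-/
theorem rot_mul_rot_mul_rot_diagonal {n : ℕ} (a b d : Basis n) :
    ∃ c : ℂ, (rot ((0, a) : Word n) * rot (0, b) * rot (0, d) * rot (0, a + b + d)).1 =
      c • (rot ((0, a + b) : Word n) * rot (0, a + d) * rot (0, b + d)).1 := by
  refine ⟨((√2 : ℝ) : ℂ)⁻¹ * (1 + Complex.I), ?_⟩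
  simp only [Submonoid.coe_mul, coe_rot_diagonal, smul_mul_smul_comm,
    Matrix.diagonal_mul_diagonal, smul_smul]
  rw [← Matrix.diagonal_smul, ← Matrix.diagonal_smul]
  refine congrArg Matrix.diagonal (funext fun x => ?_)
  simp only [phaseVal, add_dotProduct, sgn_add, Pi.smul_apply, smul_eq_mul]
  generalize hp : sgn (a ⬝ᵥ x) = p
  generalize hq : sgn (b ⬝ᵥ x) = q
  generalize hr : sgn (d ⬝ᵥ x) = r
  have key : (1 + Complex.I * p) * (1 + Complex.I * q) * (1 + Complex.I * r) *
      (1 + Complex.I * (p * q * r)) = (1 + Complex.I) * ((1 + Complex.I * (p * q)) *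
        (1 + Complex.I * (p * r)) * (1 + Complex.I * (q * r))) := by
    rcases sgn_eq_one_or (a := a ⬝ᵥ x) with h1 | h1 <;>
      rcases sgn_eq_one_or (a := b ⬝ᵥ x) with h2 | h2 <;>
      rcases sgn_eq_one_or (a := d ⬝ᵥ x) with h3 | h3 <;>
      rw [← hp, ← hq, ← hr, h1, h2, h3] <;> apply Complex.ext <;> simp
  rw [key]
  ring

/-! ### The gates in terms of words and rotations -/

theorem onQubitMatrix_apply {n : ℕ} (i : Fin n) (A : Matrix (Fin 2) (Fin 2) ℂ) (x y : Basis n) :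
    onQubitMatrix i A x y = if ∀ k, k ≠ i → x k = y k then A (x i) (y i) else 0 := by
  simp only [onQubitMatrix, tensor, Matrix.of_apply]
  rw [← Finset.mul_prod_erase _ _ (Finset.mem_univ i), Function.update_self]
  split_ifs with hxy
  · rw [Finset.prod_eq_one, mul_one]
    intro k hk
    have hki := Finset.ne_of_mem_erase hk
    rw [Function.update_of_ne hki, hxy k hki, Matrix.one_apply_eq]
  · push Not at hxy
    obtain ⟨k, hki, hk⟩ := hxy
    rw [Finset.prod_eq_zero (Finset.mem_erase.mpr ⟨hki, Finset.mem_univ k⟩), mul_zero]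
    rw [Function.update_of_ne hki, Matrix.one_apply_ne hk]

theorem onQubitMatrix_smul {n : ℕ} (i : Fin n) (c : ℂ) (A : Matrix (Fin 2) (Fin 2) ℂ) :
    onQubitMatrix i (c • A) = c • onQubitMatrix i A := by
  ext x y
  simp only [onQubitMatrix_apply, Matrix.smul_apply, smul_eq_mul, mul_ite, mul_zero]

theorem onQubitMatrix_add {n : ℕ} (i : Fin n) (A B : Matrix (Fin 2) (Fin 2) ℂ) :
    onQubitMatrix i (A + B) = onQubitMatrix i A + onQubitMatrix i B := by
  ext x y
  simp only [onQubitMatrix_apply, Matrix.add_apply]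
  split_ifs <;> simp

theorem onQubit_gateZ {n : ℕ} (i : Fin n) : onQubit i gateZ = word (zLetter i) := by
  apply Subtype.ext
  rw [onQubit_Z, coe_word]
  ext x y
  by_cases hxy : x = y
  · subst hxy
    rcases fin_two_eq_zero_or_one (x i) with hx | hx <;> simp [wordMatrix, zLetter, sgn, hx]
  · simp [wordMatrix, zLetter, hxy]

theorem onQubit_gateX {n : ℕ} (i : Fin n) : onQubit i gateX = word (xLetter i) := by
  apply Subtype.ext
  rw [coe_word]
  ext x y
  simp only [onQubit, MonoidHom.coe_mk, OneHom.coe_mk, onQubitMatrix_apply, wordMatrix, xLetter,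
    Matrix.of_apply, zero_dotProduct, sgn_zero]
  have h1 : x = y + Pi.single i 1 ↔ (∀ k, k ≠ i → x k = y k) ∧ x i = y i + 1 := by
    constructor
    · rintro rfl
      exact ⟨fun k hk => by simp [hk], by simp⟩
    · rintro ⟨h1, h2⟩
      funext k
      by_cases hk : k = i
      · subst hk; simp [h2]
      · simp [hk, h1 k hk]
  rw [if_congr h1 rfl rfl, ite_and]
  congr 1
  generalize x i = a
  generalize y i = b
  fin_cases a <;> fin_cases b <;> simp [gateX]

theorem coe_onQubit_gateH {n : ℕ} (i : Fin n) : (onQubit i gateH).1 =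
    ((√2 : ℝ) : ℂ)⁻¹ • (wordMatrix (xLetter i) + wordMatrix (zLetter i)) := by
  rw [← coe_word, ← coe_word, ← onQubit_gateX, ← onQubit_gateZ]
  simp only [onQubit, MonoidHom.coe_mk, OneHom.coe_mk]
  rw [← onQubitMatrix_add, ← onQubitMatrix_smul]
  congr 1
  ext a b
  fin_cases a <;> fin_cases b <;> simp [gateH, gateX, gateZ]

/-- Since `H = (X + Z) / √2` and `ZX = -XZ`, the product `Z H` equals `(1 - XZ) / √2`; here `XZ`
already has square `-1`. -/
theorem word_zLetter_mul_gateH {n : ℕ} (i : Fin n) :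
    word (zLetter i) * onQubit i gateH = (rot (xLetter i + zLetter i))⁻¹ := by
  apply Subtype.ext
  rw [Submonoid.coe_mul, coe_rot_inv, coe_onQubit_gateH, coe_word, mul_smul_comm, mul_add,
    wordMatrix_mul, wordMatrix_mul_self]
  congr 1
  simp [skew, xLetter, zLetter, sgn, add_comm, sub_eq_add_neg]

theorem word_zLetter_mul_self {n : ℕ} (i : Fin n) :
    word (zLetter i) * word (zLetter i) = 1 := by
  rw [← onQubit_gateZ, ← map_mul, gateZ_sq, map_one]

theorem gateH_eq {n : ℕ} (i : Fin n) :
    onQubit i gateH = word (zLetter i) * (rot (xLetter i + zLetter i))⁻¹ := by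
  rw [← word_zLetter_mul_gateH, ← mul_assoc, word_zLetter_mul_self, one_mul]

theorem Act.of_mul_eq {n : ℕ} {g : U n} {v w : Word n} (hg : g * word v = word w * g) :
    Act g v w := by
  refine ⟨1, ?_⟩
  rw [one_smul]
  exact congrArg Subtype.val hg

theorem act_gateH_xLetter {n : ℕ} (i : Fin n) :
    Act (onQubit i gateH) (xLetter i) (zLetter i) := by
  refine Act.of_mul_eq ?_
  rw [← onQubit_gateX, ← onQubit_gateZ, ← map_mul, ← map_mul, gateH_mul_X]

theorem act_gateH_zLetter {n : ℕ} (i : Fin n) :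
    Act (onQubit i gateH) (zLetter i) (xLetter i) := by
  refine Act.of_mul_eq ?_
  rw [← onQubit_gateX, ← onQubit_gateZ, ← map_mul, ← map_mul, gateH_mul_Z]

theorem act_onQubit_xLetter {n : ℕ} {i j : Fin n} (hij : i ≠ j)
    (A : Matrix.unitaryGroup (Fin 2) ℂ) : Act (onQubit i A) (xLetter j) (xLetter j) := by
  refine Act.of_mul_eq ?_
  rw [← onQubit_gateX, onQubit_comm hij]

theorem act_onQubit_zLetter {n : ℕ} {i j : Fin n} (hij : i ≠ j)
    (A : Matrix.unitaryGroup (Fin 2) ℂ) : Act (onQubit i A) (zLetter j) (zLetter j) := by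
  refine Act.of_mul_eq ?_
  rw [← onQubit_gateZ, onQubit_comm hij]

theorem act_gateCZ_zLetter {n : ℕ} (i j k : Fin n) :
    Act (gateCZ i j) (zLetter k) (zLetter k) := by
  refine Act.of_mul_eq ?_
  rw [← onQubit_gateZ, CZ_mul_Z]

theorem act_gateCZ_xLetter_of_ne {n : ℕ} {i j k : Fin n} (hi : i ≠ k) (hj : j ≠ k) :
    Act (gateCZ i j) (xLetter k) (xLetter k) := by
  refine Act.of_mul_eq ?_
  rw [← onQubit_gateX, CZ_mul_X_of_ne hi hj]

theorem act_gateCZ_xLetter {n : ℕ} {i j : Fin n} (hij : i ≠ j) :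
    Act (gateCZ i j) (xLetter i) (zLetter j + xLetter i) := by
  have h1 : (word (zLetter j) * word (xLetter i)).1 =
      sgn ((zLetter j).2 ⬝ᵥ (xLetter i).1) • wordMatrix (zLetter j + xLetter i) := wordMatrix_mul _ _
  refine ⟨sgn ((zLetter j).2 ⬝ᵥ (xLetter i).1), ?_⟩
  rw [← smul_mul_assoc, ← h1, ← onQubit_gateX, ← onQubit_gateZ, ← Submonoid.coe_mul,
    ← CZ_mul_X hij, Submonoid.coe_mul, onQubit_gateX, coe_word]

section gateS

variable {n : ℕ} {ω : ℂ} (hω : IsPrimitiveRoot ω 8)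

/-- The number `ω²` is `i` or `-i` according to the choice of `ω`; this decides between the rotation
and its inverse. -/
theorem coe_gateS_eq (i : Fin n) : ∃ c : ℂ, (onQubit i (gateS hω)).1 = c • (rot (zLetter i)).1 ∨
    (onQubit i (gateS hω)).1 = c • (rot (zLetter i))⁻¹.1 := by
  have h2 : ((√2 : ℝ) : ℂ) ≠ 0 := by simp
  have hS : (onQubit i (gateS hω)).1 =
      ((1 + ω ^ 2) / 2) • 1 + ((1 - ω ^ 2) / 2) • wordMatrix (zLetter i) := by
    rw [← coe_word, ← onQubit_gateZ]
    simp only [onQubit, MonoidHom.coe_mk, OneHom.coe_mk]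
    rw [← onQubitMatrix_one i, ← onQubitMatrix_smul, ← onQubitMatrix_smul, ← onQubitMatrix_add]
    congr 1
    ext a b
    fin_cases a <;> fin_cases b <;> simp [gateS, gateZ] <;> ring
  have hsk : skew (zLetter i) = Complex.I • wordMatrix (zLetter i) := by simp [skew, zLetter]
  have hI := Complex.I_mul_I
  have h3 : (ω ^ 2 + Complex.I) * (ω ^ 2 - Complex.I) = 0 := by
    linear_combination sq_of_primitive hω - hI
  rcases mul_eq_zero.mp h3 with h4 | h4
  · refine ⟨((√2 : ℝ) : ℂ) * ((1 + ω ^ 2) / 2), Or.inl ?_⟩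
    rw [hS, coe_rot, hsk, smul_smul, mul_right_comm, mul_inv_cancel₀ h2, one_mul, smul_add,
      smul_smul]
    congr 2
    rw [eq_neg_of_add_eq_zero_left h4]
    linear_combination (1 / 2) * hI
  · refine ⟨((√2 : ℝ) : ℂ) * ((1 + ω ^ 2) / 2), Or.inr ?_⟩
    rw [hS, coe_rot_inv, hsk, smul_smul, mul_right_comm, mul_inv_cancel₀ h2, one_mul, smul_sub,
      smul_smul, sub_eq_add_neg (_ • (1 : Matrix (Basis n) (Basis n) ℂ)), ← neg_smul]
    congr 2
    rw [sub_eq_zero.mp h4]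
    linear_combination (1 / 2) * hI

theorem gateS_mem_iff {N : Subgroup (U n)} (hN : phases n ≤ N) (i : Fin n) :
    onQubit i (gateS hω) ∈ N ↔ rot (zLetter i) ∈ N := by
  obtain ⟨c, hc | hc⟩ := coe_gateS_eq hω i
  · exact mul_mem_phases_iff hN hc
  · rw [mul_mem_phases_iff hN hc, inv_mem_iff]

theorem act_gateS_zLetter (i j : Fin n) :
    Act (onQubit i (gateS hω)) (zLetter j) (zLetter j) := by
  by_cases hij : i = j
  · subst hij
    refine Act.of_mul_eq ?_
    rw [← onQubit_gateZ, ← gateS_sq hω, ← map_mul, ← map_mul, mul_assoc]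
  · exact act_onQubit_zLetter hij _

theorem act_gateS_xLetter (i : Fin n) :
    Act (onQubit i (gateS hω)) (xLetter i) (xLetter i + zLetter i) := by
  have h1 := congrArg Subtype.val (S_mul_X hω i)
  refine ⟨ω ^ 2, ?_⟩
  rw [onQubit_gateX, onQubit_gateZ] at h1
  simp only [Submonoid.coe_mul, coe_word, wordMatrix_mul, phaseGate] at h1
  rw [h1]
  simp [xLetter, zLetter, sgn]

end gateS

/-! ### Subgroups of the projective Clifford group and their preimages -/

section lift

variable {n : ℕ} {ω : ℂ} (hω : IsPrimitiveRoot ω 8)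

theorem toC_mul {u v : U n} (hu : u ∈ clifford n hω) (hv : v ∈ clifford n hω) :
    toC hω u hu * toC hω v hv = toC hω (v * u) (mul_mem hv hu) := rfl

theorem toC_inv {u : U n} (hu : u ∈ clifford n hω) :
    (toC hω u hu)⁻¹ = toC hω u⁻¹ (inv_mem hu) := rfl

theorem toC_pow {u : U n} (hu : u ∈ clifford n hω) (k : ℕ) :
    toC hω u hu ^ k = toC hω (u ^ k) (pow_mem hu k) := rfl

theorem toC_one : toC hω (1 : U n) (one_mem _) = 1 := rfl

theorem toC_congr {u v : U n} (huv : u = v) (hu : u ∈ clifford n hω) :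
    toC hω u hu = toC hω v (huv ▸ hu) := by
  subst huv; rfl

theorem exists_toC (g : C n hω) : ∃ u, ∃ hu : u ∈ clifford n hω, g = toC hω u hu := by
  induction g using MulOpposite.rec' with
  | h g =>
    induction g using QuotientGroup.induction_on with
    | H u => exact ⟨u.1, u.2, rfl⟩

theorem toC_eq_iff {u v : U n} (hu : u ∈ clifford n hω) (hv : v ∈ clifford n hω) :
    toC hω u hu = toC hω v hv ↔ u⁻¹ * v ∈ phases n := by
  rw [toC, toC, MulOpposite.op_inj, QuotientGroup.eq]
  rfl

/-- The preimage in the Clifford group of a subgroup of the projective Clifford group. -/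
def preimage (N : Subgroup (C n hω)) : Subgroup (U n) where
  carrier := {u | ∃ hu : u ∈ clifford n hω, toC hω u hu ∈ N}
  one_mem' := ⟨one_mem _, N.one_mem⟩
  mul_mem' := by
    rintro u v ⟨hu, hu'⟩ ⟨hv, hv'⟩
    exact ⟨mul_mem hu hv, N.mul_mem hv' hu'⟩
  inv_mem' := by
    rintro u ⟨hu, hu'⟩
    exact ⟨inv_mem hu, N.inv_mem hu'⟩

variable {hω}

theorem toC_mem_iff {N : Subgroup (C n hω)} {u : U n} (hu : u ∈ clifford n hω) :
    toC hω u hu ∈ N ↔ u ∈ preimage hω N := ⟨fun hN => ⟨hu, hN⟩, fun ⟨_, hN⟩ => hN⟩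

theorem phases_le_clifford : phases n ≤ clifford n hω := by
  rintro u ⟨c, hc⟩
  have hcomm : ∀ p : U n, u * p * u⁻¹ = p := by
    intro p
    rw [mul_inv_eq_iff_eq_mul]
    apply Subtype.ext
    rw [Submonoid.coe_mul, Submonoid.coe_mul, hc]
    simp
  rw [clifford, Subgroup.mem_normalizer_iff]
  intro p
  rw [hcomm]

theorem phases_le_preimage (N : Subgroup (C n hω)) : phases n ≤ preimage hω N := by
  intro u hu
  refine ⟨phases_le_clifford hu, ?_⟩
  have : toC hω u (phases_le_clifford hu) = 1 := by
    rw [← toC_one, toC_eq_iff, mul_one]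
    exact inv_mem hu
  rw [this]
  exact N.one_mem

theorem exists_eq_smul_wordMatrix {p : U n} (hp : p ∈ pauli n hω) :
    ∃ (c : ℂ) (v : Word n), p.1 = c • wordMatrix v := by
  induction hp using Subgroup.closure_induction with
  | mem x hx =>
    rcases hx with (⟨i, rfl⟩ | ⟨i, rfl⟩) | hx
    · exact ⟨1, xLetter i, by rw [one_smul]; exact congrArg Subtype.val (onQubit_gateX i)⟩
    · exact ⟨1, zLetter i, by rw [one_smul]; exact congrArg Subtype.val (onQubit_gateZ i)⟩
    · obtain rfl : x = phaseGate n hω := hx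
      exact ⟨ω ^ 2, 0, by rw [wordMatrix_zero]; rfl⟩
  | one => exact ⟨1, 0, by rw [wordMatrix_zero, one_smul]; rfl⟩
  | mul x y _ _ hx hy =>
    obtain ⟨c, v, hc⟩ := hx
    obtain ⟨d, w, hd⟩ := hy
    exact ⟨_, v + w, by
      rw [Submonoid.coe_mul, hc, hd, smul_mul_smul_comm, wordMatrix_mul, smul_smul]⟩
  | inv x _ hx =>
    obtain ⟨c, v, hc⟩ := hx
    exact ⟨_, v, by
      rw [show (x⁻¹ : U n).1 = star x.1 from rfl, hc, star_smul, star_wordMatrix, smul_smul]⟩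

/-- For the letters this is the normalizer condition, since elements of the Pauli group are
multiples of words; multiplicativity gives all other words. -/
theorem exists_act {u : U n} (hu : u ∈ clifford n hω) (v : Word n) : ∃ w, Act u v w := by
  have key : ∀ v, word v ∈ pauli n hω → ∃ w, Act u v w := by
    intro v hv
    rw [clifford, Subgroup.mem_normalizer_iff] at hu
    obtain ⟨c, w, hc⟩ := exists_eq_smul_wordMatrix ((hu _).mp hv)
    refine ⟨w, c, ?_⟩
    rw [← smul_mul_assoc, ← hc, ← Submonoid.coe_mul, inv_mul_cancel_right]
    rfl
  refine word_induction (P := fun v => ∃ w, Act u v w) ⟨0, 1, ?_⟩ ?_ (fun i => key _ ?_)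
    (fun i => key _ ?_) v
  · rw [wordMatrix_zero]; simp
  · rintro v v' ⟨w, hw⟩ ⟨w', hw'⟩
    exact ⟨w + w', hw.add hw'⟩
  · rw [← onQubit_gateX]; exact X_mem hω i
  · rw [← onQubit_gateZ]; exact Z_mem hω i

theorem s_sq (i : Fin n) : s hω i ^ 2 = toC hω (word (zLetter i))
    (by rw [← onQubit_gateZ, ← gateS_sq hω, map_mul]; exact mul_mem (S_mem hω i) (S_mem hω i)) := by
  rw [s, toC_pow]
  apply toC_congr
  rw [pow_two, ← map_mul, gateS_sq, onQubit_gateZ]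

theorem s_pow_four (i : Fin n) : s hω i ^ 4 = 1 := by
  rw [show 4 = 2 * 2 by rfl, pow_mul, s_sq, toC_pow, toC_congr hω (v := 1), toC_one]
  rw [pow_two, word_zLetter_mul_self]

theorem h_mul_self (i : Fin n) : h hω i * h hω i = 1 := by
  rw [h, toC_mul, toC_congr hω (v := 1), toC_one]
  rw [← map_mul, gateH_sq, map_one]

/-- Commuting in the quotient means commuting up to a phase, and `s_i²` is the class of `Z_i`. -/
theorem toC_mem_centralizer_iff {i : Fin n} {u : U n} (hu : u ∈ clifford n hω) :
    toC hω u hu ∈ Subgroup.centralizer {s hω i ^ 2} ↔ Act u (zLetter i) (zLetter i) := by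
  rw [Subgroup.mem_centralizer_singleton_iff, s_sq, toC_mul, toC_mul, toC_eq_iff]
  constructor
  · rintro ⟨c, hc⟩
    have h1 : u * word (zLetter i) =
        word (zLetter i) * u * ((word (zLetter i) * u)⁻¹ * (u * word (zLetter i))) := by group
    have h2 : (u * word (zLetter i)).1 = (word (zLetter i) * u).1 *
        ((word (zLetter i) * u)⁻¹ * (u * word (zLetter i))).1 := congrArg Subtype.val h1
    rw [hc, mul_smul_comm, mul_one] at h2
    exact ⟨c, h2⟩
  · rintro ⟨c, hc⟩
    have h1 : (u * word (zLetter i)).1 = c • (word (zLetter i) * u).1 := hc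
    refine ⟨c, ?_⟩
    rw [Submonoid.coe_mul, h1, mul_smul_comm, coe_inv_mul_coe]

end lift

/-! ### Transport of membership along the action -/

theorem Act.conj_rot_mem {n : ℕ} {N : Subgroup (U n)} {g : U n} {v w : Word n} (hg : Act g v w) :
    g * rot v * g⁻¹ ∈ N ↔ rot w ∈ N := by
  rcases hg.conj_rot with h1 | h1 <;> rw [h1]
  exact inv_mem_iff

theorem Act.rot_mem {n : ℕ} {N : Subgroup (U n)} {g : U n} {v w : Word n} (hg : Act g v w)
    (hgN : g ∈ N) (hv : rot v ∈ N) : rot w ∈ N :=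
  hg.conj_rot_mem.mp (N.mul_mem (N.mul_mem hgN hv) (N.inv_mem hgN))

theorem Act.conj_word_mem {n : ℕ} {N : Subgroup (U n)} (hN : phases n ≤ N) {g : U n}
    {v w : Word n} (hg : Act g v w) : g * word v * g⁻¹ ∈ N ↔ word w ∈ N := by
  obtain ⟨c, hc⟩ := hg
  refine mul_mem_phases_iff hN (c := c) ?_
  rw [Submonoid.coe_mul, Submonoid.coe_mul, coe_word, hc, smul_mul_assoc, mul_assoc,
    coe_mul_coe_inv, mul_one, coe_word]

theorem conj_word_mul_rot_inv_mem {n : ℕ} {N : Subgroup (U n)} (hN : phases n ≤ N) {g : U n}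
    {a b y z : Word n} (ha : Act g a b) (hy : Act g y z) (hz : rot z ∈ N) :
    g * (word a * (rot y)⁻¹) * g⁻¹ ∈ N ↔ word b ∈ N := by
  rw [show g * (word a * (rot y)⁻¹) * g⁻¹ = (g * word a * g⁻¹) * (g * rot y * g⁻¹)⁻¹ by group,
    N.mul_mem_cancel_right (N.inv_mem (hy.conj_rot_mem.mpr hz)), ha.conj_word_mem hN]

theorem conj_word_mul_rot_inv_mem' {n : ℕ} {N : Subgroup (U n)} (hN : phases n ≤ N) {g : U n}
    {a b y z : Word n} (ha : Act g a b) (hy : Act g y z) (hb : word b ∈ N) :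
    g * (word a * (rot y)⁻¹) * g⁻¹ ∈ N ↔ rot z ∈ N := by
  rw [show g * (word a * (rot y)⁻¹) * g⁻¹ = (g * word a * g⁻¹) * (g * rot y * g⁻¹)⁻¹ by group,
    N.mul_mem_cancel_left ((ha.conj_word_mem hN).mpr hb), inv_mem_iff, hy.conj_rot_mem]

section subgroups

variable {n : ℕ} {ω : ℂ} {hω : IsPrimitiveRoot ω 8}

/-! ### A criterion for containing the centralizer -/

theorem centralizer_le_of_rot_mem (hn : 0 < n) {N : Subgroup (C n hω)}
    (hx0 : word (xLetter ⟨0, hn⟩) ∈ preimage hω N) (hz0 : rot (zLetter ⟨0, hn⟩) ∈ preimage hω N)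
    (hx : ∀ i : Fin n, 1 ≤ i.val → rot (xLetter i) ∈ preimage hω N)
    (hz : ∀ i : Fin n, 1 ≤ i.val → rot (zLetter i) ∈ preimage hω N)
    (hzx : ∀ (k : ℕ) (hk : k + 1 < n),
      rot (zLetter (⟨k, by omega⟩ : Fin n) + xLetter ⟨k + 1, hk⟩) ∈ preimage hω N) :
    Subgroup.centralizer {s hω ⟨0, hn⟩ ^ 2} ≤ N := by
  intro g hg
  obtain ⟨u, hu, rfl⟩ := exists_toC hω g
  rw [toC_mem_centralizer_iff] at hg
  rw [toC_mem_iff]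
  refine mem_of_act_zLetter hn (phases_le_preimage N) (fun k hk => exists_act hk.choose)
    (fun t ht => ?_) hx0 (exists_act hu) hg
  by_cases hne : t = zLetter ⟨0, hn⟩
  · rw [hne]; exact hz0
  · exact rot_mem_of_generators hn (phases_le_preimage N) hx hz hzx ht hne

variable {N : Subgroup (C n hω)}

theorem rot_zLetter_mem {i : Fin n} (hs : s hω i ∈ N) : rot (zLetter i) ∈ preimage hω N :=
  (gateS_mem_iff hω (phases_le_preimage N) i).mp ((toC_mem_iff _).mp hs)

theorem rot_xLetter_mem {i : Fin n} (hh : h hω i ∈ N) (hs : s hω i ∈ N) :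
    rot (xLetter i) ∈ preimage hω N :=
  (act_gateH_zLetter i).rot_mem ((toC_mem_iff _).mp hh) (rot_zLetter_mem hs)

theorem rot_zLetter_add_xLetter_mem {k : ℕ} (hk : k + 1 < n) (hΛ : Λ hω k hk ∈ N)
    (hx : rot (xLetter (⟨k + 1, hk⟩ : Fin n)) ∈ preimage hω N) :
    rot (zLetter (⟨k, by omega⟩ : Fin n) + xLetter ⟨k + 1, hk⟩) ∈ preimage hω N := by
  have h1 : gateCZ (⟨k, by omega⟩ : Fin n) ⟨k + 1, hk⟩ ∈ preimage hω N := (toC_mem_iff _).mp hΛ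
  rw [gateCZ_comm] at h1
  exact (act_gateCZ_xLetter (by simp [Fin.ext_iff])).rot_mem h1 hx

/-! ### The conjugating element -/

/-- The inverse of `S H` on qubit `i`. -/
noncomputable def frameChange {n : ℕ} {ω : ℂ} (hω : IsPrimitiveRoot ω 8) (i : Fin n) : U n :=
  (onQubit i (gateS hω) * onQubit i gateH)⁻¹

theorem h_mul_s_inv (i : Fin n) : (h hω i * s hω i)⁻¹ = s hω i ^ 3 * h hω i := by
  rw [mul_inv_rev, inv_eq_of_mul_eq_one_left (h_mul_self i), inv_eq_of_mul_eq_one_left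
    (show s hω i ^ 3 * s hω i = 1 by rw [← pow_succ, s_pow_four])]

theorem frameChange_conj_mem {i : Fin n} {u : U n} (hu : u ∈ clifford n hω) :
    frameChange hω i * u * (frameChange hω i)⁻¹ ∈ clifford n hω := by
  have : frameChange hω i ∈ clifford n hω := inv_mem (mul_mem (S_mem hω i) (H_mem hω i))
  exact mul_mem (mul_mem this hu) (inv_mem this)

theorem conj_toC (i : Fin n) {u : U n} (hu : u ∈ clifford n hω) :
    h hω i * s hω i * toC hω u hu * (h hω i * s hω i)⁻¹ =
      toC hω (frameChange hω i * u * (frameChange hω i)⁻¹) (frameChange_conj_mem hu) := by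
  rw [h, s, toC_mul, toC_inv, toC_mul, toC_mul]
  apply toC_congr
  rw [frameChange, inv_inv, mul_assoc]

/-- On qubit `i` the frame change cycles `Y → Z → X → Y`, hence turns the stabilizer of `Y_i` into
that of `Z_i`. -/
theorem act_frameChange_add (i : Fin n) :
    Act (frameChange hω i) (xLetter i + zLetter i) (zLetter i) :=
  ((act_gateS_xLetter hω i).mul (act_gateH_zLetter i)).inv

theorem act_frameChange_zLetter (i : Fin n) :
    Act (frameChange hω i) (zLetter i) (xLetter i) :=
  ((act_gateS_zLetter hω i i).mul (act_gateH_xLetter i)).inv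

theorem act_frameChange_xLetter (i : Fin n) :
    Act (frameChange hω i) (xLetter i) (xLetter i + zLetter i) := by
  have := (act_frameChange_add (hω := hω) i).add (act_frameChange_zLetter i)
  rwa [add_assoc, word_add_self, add_zero, add_comm (zLetter i)] at this

theorem act_frameChange_xLetter_of_ne {i j : Fin n} (hij : i ≠ j) :
    Act (frameChange hω i) (xLetter j) (xLetter j) :=
  ((act_onQubit_xLetter hij _).mul (act_onQubit_xLetter hij _)).inv

theorem act_frameChange_zLetter_of_ne {i j : Fin n} (hij : i ≠ j) :
    Act (frameChange hω i) (zLetter j) (zLetter j) :=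
  ((act_onQubit_zLetter hij _).mul (act_onQubit_zLetter hij _)).inv

/-- In the new frame `H = Z · (rot Y)⁻¹` becomes, up to a phase, `X` times `rot Z` or its inverse. A
subgroup containing this element therefore contains the word `X` exactly when it contains `rot Z`.
-/
theorem conj_h_eq (i : Fin n) : h hω i * s hω i * h hω i * s hω i ^ 3 * h hω i =
    toC hω (frameChange hω i * onQubit i gateH * (frameChange hω i)⁻¹)
      (frameChange_conj_mem (H_mem hω i)) := by
  rw [← conj_toC, h_mul_s_inv, ← mul_assoc]
  rfl

theorem word_xLetter_mem {i : Fin n}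
    (hT : h hω i * s hω i * h hω i * s hω i ^ 3 * h hω i ∈ N)
    (hz : rot (zLetter i) ∈ preimage hω N) : word (xLetter i) ∈ preimage hω N := by
  rw [conj_h_eq, toC_mem_iff, gateH_eq] at hT
  exact (conj_word_mul_rot_inv_mem (phases_le_preimage N) (act_frameChange_zLetter i)
    (act_frameChange_add i) hz).mp hT

theorem rot_zLetter_mem_of_word_mem {i : Fin n}
    (hT : h hω i * s hω i * h hω i * s hω i ^ 3 * h hω i ∈ N)
    (hx : word (xLetter i) ∈ preimage hω N) : rot (zLetter i) ∈ preimage hω N := by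
  rw [conj_h_eq, toC_mem_iff, gateH_eq] at hT
  exact (conj_word_mul_rot_inv_mem' (phases_le_preimage N) (act_frameChange_zLetter i)
    (act_frameChange_add i) hx).mp hT

/-! ### Generators of the centralizer -/

theorem act_gateH_add (i : Fin n) :
    Act (onQubit i gateH) (xLetter i + zLetter i) (xLetter i + zLetter i) := by
  have := (act_gateH_xLetter i).add (act_gateH_zLetter i)
  rwa [add_comm (zLetter i)] at this

theorem act_conj_frameChange {i : Fin n} {u : U n}
    (hu : Act u (xLetter i + zLetter i) (xLetter i + zLetter i)) :
    Act (frameChange hω i * u * (frameChange hω i)⁻¹) (zLetter i) (zLetter i) :=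
  ((act_frameChange_add i).mul hu).mul (act_frameChange_add i).inv

theorem conj_h_mem_centralizer (i : Fin n) :
    h hω i * s hω i * h hω i * s hω i ^ 3 * h hω i ∈ Subgroup.centralizer {s hω i ^ 2} := by
  rw [conj_h_eq, toC_mem_centralizer_iff]
  exact act_conj_frameChange (act_gateH_add i)

theorem closure_le_centralizer (hn : 0 < n) : Subgroup.closure
    ({h hω ⟨0, hn⟩ * s hω ⟨0, hn⟩ * h hω ⟨0, hn⟩ * s hω ⟨0, hn⟩ ^ 3 * h hω ⟨0, hn⟩} ∪
      {u | ∃ i : Fin n, 1 ≤ i.val ∧ u = h hω i} ∪ {u | ∃ i : Fin n, u = s hω i} ∪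
      {u | ∃ (k : ℕ) (hk : k + 1 < n), u = Λ hω k hk}) ≤
    Subgroup.centralizer {s hω ⟨0, hn⟩ ^ 2} := by
  rw [Subgroup.closure_le]
  rintro _ (((rfl | ⟨i, hi, rfl⟩) | ⟨i, rfl⟩) | ⟨k, hk, rfl⟩)
  · exact conj_h_mem_centralizer _
  · exact (toC_mem_centralizer_iff _).mpr
      (act_onQubit_zLetter (by rintro rfl; simp at hi) _)
  · exact (toC_mem_centralizer_iff _).mpr (act_gateS_zLetter hω _ _)
  · exact (toC_mem_centralizer_iff _).mpr (act_gateCZ_zLetter _ _ _)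

theorem centralizer_le_closure (hn : 2 ≤ n) (h0 : 0 < n) :
    Subgroup.centralizer {s hω ⟨0, h0⟩ ^ 2} ≤ Subgroup.closure
    ({h hω ⟨0, h0⟩ * s hω ⟨0, h0⟩ * h hω ⟨0, h0⟩ * s hω ⟨0, h0⟩ ^ 3 * h hω ⟨0, h0⟩} ∪
      {u | ∃ i : Fin n, 1 ≤ i.val ∧ u = h hω i} ∪ {u | ∃ i : Fin n, 1 ≤ i.val ∧ u = s hω i} ∪
      {u | ∃ (k : ℕ) (hk : k + 1 < n), u = Λ hω k hk}) := by
  set G : Subgroup (C n hω) := Subgroup.closure _ with hG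
  have hT : h hω ⟨0, h0⟩ * s hω ⟨0, h0⟩ * h hω ⟨0, h0⟩ * s hω ⟨0, h0⟩ ^ 3 * h hω ⟨0, h0⟩ ∈ G :=
    Subgroup.subset_closure (Or.inl (Or.inl (Or.inl rfl)))
  have hh : ∀ i : Fin n, 1 ≤ i.val → h hω i ∈ G := fun i hi =>
    Subgroup.subset_closure (Or.inl (Or.inl (Or.inr ⟨i, hi, rfl⟩)))
  have hs : ∀ i : Fin n, 1 ≤ i.val → s hω i ∈ G := fun i hi =>
    Subgroup.subset_closure (Or.inl (Or.inr ⟨i, hi, rfl⟩))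
  have hΛ : ∀ (k : ℕ) (hk : k + 1 < n), Λ hω k hk ∈ G := fun k hk =>
    Subgroup.subset_closure (Or.inr ⟨k, hk, rfl⟩)
  have hx : ∀ i : Fin n, 1 ≤ i.val → rot (xLetter i) ∈ preimage hω G := fun i hi =>
    rot_xLetter_mem (hh i hi) (hs i hi)
  have hz : ∀ i : Fin n, 1 ≤ i.val → rot (zLetter i) ∈ preimage hω G := fun i hi =>
    rot_zLetter_mem (hs i hi)
  have hzx : ∀ (k : ℕ) (hk : k + 1 < n),
      rot (zLetter (⟨k, by omega⟩ : Fin n) + xLetter ⟨k + 1, hk⟩) ∈ preimage hω G := fun k hk =>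
    rot_zLetter_add_xLetter_mem hk (hΛ k hk) (hx _ (by simp))
  -- The one missing rotation: `Z₁Z₂` is not the exceptional word, so its rotation is available, and
  -- the `CZ` relation yields `rot Z₁` without `s₁`.
  have hz0 : rot (zLetter (⟨0, h0⟩ : Fin n)) ∈ preimage hω G := by
    obtain ⟨c, hc⟩ := rot_mul_rot_diagonal (i := (⟨0, h0⟩ : Fin n)) (j := ⟨1, hn⟩)
    rw [← (preimage hω G).mul_mem_cancel_right (hz ⟨1, hn⟩ le_rfl),
      mul_mem_phases_iff (phases_le_preimage G) hc]
    refine mul_mem ((toC_mem_iff _).mp (hΛ 0 hn)) (rot_mem_of_generators h0 (phases_le_preimage G)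
      hx hz hzx ?_ ?_)
    · rw [form_add_right, form_self, form_zLetter_zLetter, add_zero]
    · intro he
      have := congrArg (fun v : Word n => v.2 ⟨1, hn⟩) he
      simp [zLetter] at this
  exact centralizer_le_of_rot_mem h0 (word_xLetter_mem hT hz0) hz0 hx hz hzx

theorem centralizer_le_closure_one (h0 : 0 < 1) {ω : ℂ} {hω : IsPrimitiveRoot ω 8}
    {N : Subgroup (C 1 hω)}
    (hT : h hω ⟨0, h0⟩ * s hω ⟨0, h0⟩ * h hω ⟨0, h0⟩ * s hω ⟨0, h0⟩ ^ 3 * h hω ⟨0, h0⟩ ∈ N)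
    (hs : s hω ⟨0, h0⟩ ∈ N) : Subgroup.centralizer {s hω ⟨0, h0⟩ ^ 2} ≤ N :=
  centralizer_le_of_rot_mem h0 (word_xLetter_mem hT (rot_zLetter_mem hs)) (rot_zLetter_mem hs)
    (fun i hi => absurd i.isLt (by omega)) (fun i hi => absurd i.isLt (by omega))
    (fun k hk => absurd hk (by omega))

/-! ### The inertia subgroup -/

/-- The operator whose class is `M`. -/
noncomputable def opM {n : ℕ} (o i : Fin n) : U n :=
  onQubit i gateH * gateCZ o i * onQubit i gateH * word (zLetter o) * onQubit o gateH *
    onQubit i gateH * word (zLetter i) * gateCZ o i * onQubit i gateH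

theorem M_eq (hn : 2 ≤ n) (h0 : 0 < n) :
    ∃ hM, M hω hn = toC hω (opM (⟨0, h0⟩ : Fin n) ⟨1, hn⟩) hM := by
  refine ⟨?_, ?_⟩
  · have hZ : ∀ i : Fin n, word (zLetter i) ∈ clifford n hω := fun i => by
      rw [← onQubit_gateZ, ← gateS_sq hω, map_mul]
      exact mul_mem (S_mem hω i) (S_mem hω i)
    have hCZ : gateCZ (⟨0, h0⟩ : Fin n) ⟨1, hn⟩ ∈ clifford n hω :=
      CZ_mem hω (by simp [Fin.ext_iff])
    have hH := H_mem (n := n) hω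
    exact mul_mem (mul_mem (mul_mem (mul_mem (mul_mem (mul_mem (mul_mem (mul_mem (hH _) hCZ)
      (hH _)) (hZ _)) (hH _)) (hH _)) (hZ _)) hCZ) (hH _)
  · simp only [M, s_sq, h, Λ, toC_mul]
    apply toC_congr
    simp only [opM, mul_assoc]

theorem gateH_mul_self (i : Fin n) :
    (onQubit i gateH : U n) * onQubit i gateH = 1 := by
  rw [← map_mul, gateH_sq, map_one]

theorem gateH_mul_word_zLetter (i : Fin n) :
    onQubit i gateH * word (zLetter i) = word (xLetter i) * onQubit i gateH := by
  rw [← onQubit_gateX, ← onQubit_gateZ, ← map_mul, ← map_mul, gateH_mul_Z]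

theorem sandwich_eq {G : Type*} [Group G] {a b z k w r x : G} (ha : a * a = 1) (hb : b * b = 1)
    (hzk : z * k = r⁻¹) (haw : a * w = x * a) : a * b * a * z * k * a * w * b * a =
      (a * b * a * r * (a * b * a)⁻¹)⁻¹ * (a * b * a * x * (a * b * a)⁻¹) := by
  have hinv : (a * b * a)⁻¹ = a * b * a := by
    rw [mul_inv_rev, mul_inv_rev, inv_eq_of_mul_eq_one_left ha, inv_eq_of_mul_eq_one_left hb,
      mul_assoc]
  calc a * b * a * z * k * a * w * b * a = a * b * a * (z * k) * (a * w) * b * a := by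
        simp only [mul_assoc]
    _ = a * b * a * r⁻¹ * x * (a * b * a)⁻¹ := by
        rw [hzk, haw, hinv]
        simp only [mul_assoc]
    _ = _ := by group

/-- With the involution `g = H_i CZ H_i` (a controlled `X` gate), `opM` is the conjugate by `g` of
`(rot Y_o)⁻¹ X_i`. Up to a phase it is thus a rotation about `Y_o X_i`, or its inverse, times `X_i`.
-/
theorem exists_opM_eq {o i : Fin n} (hoi : o ≠ i) : ∃ g : U n,
    opM o i = (g * rot (xLetter o + zLetter o) * g⁻¹)⁻¹ * (g * word (xLetter i) * g⁻¹) ∧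
      Act g (xLetter o + zLetter o) (xLetter o + zLetter o + xLetter i) ∧
      Act g (xLetter i) (xLetter i) := by
  refine ⟨onQubit i gateH * gateCZ o i * onQubit i gateH, sandwich_eq (gateH_mul_self i)
    (gateCZ_sq o i) (word_zLetter_mul_gateH o) (gateH_mul_word_zLetter i), ?_, ?_⟩
  · refine Act.mul (w := xLetter o + zLetter o) (Act.mul
      (w := xLetter o + zLetter o + zLetter i) ?_ ?_) ?_
    · exact ((act_onQubit_xLetter hoi.symm _).add (act_onQubit_zLetter hoi.symm _)).add
        (act_gateH_zLetter i)
    · have := (act_gateCZ_xLetter hoi).add (act_gateCZ_zLetter o i o)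
      rwa [add_comm (zLetter i), add_right_comm] at this
    · exact (act_onQubit_xLetter hoi.symm _).add (act_onQubit_zLetter hoi.symm _)
  · exact ((act_gateH_zLetter i).mul (act_gateCZ_zLetter o i i)).mul (act_gateH_xLetter i)

theorem conj_mem_preimage_map {I : Subgroup (C n hω)} {u : U n} (o : Fin n)
    (hu : u ∈ preimage hω I) : frameChange hω o * u * (frameChange hω o)⁻¹ ∈
      preimage hω (I.map (MulAut.conj (h hω o * s hω o)).toMonoidHom) := by
  obtain ⟨hu, hI⟩ := hu
  exact ⟨frameChange_conj_mem hu, ⟨_, hI, conj_toC o hu⟩⟩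

theorem conj_toC_mem_centralizer {o : Fin n} {u : U n} (hu : u ∈ clifford n hω)
    (hact : Act u (xLetter o + zLetter o) (xLetter o + zLetter o)) :
    toC hω u hu ∈ (Subgroup.centralizer {s hω o ^ 2}).comap
      (MulAut.conj (h hω o * s hω o)).toMonoidHom := by
  rw [Subgroup.mem_comap]
  change h hω o * s hω o * toC hω u hu * (h hω o * s hω o)⁻¹ ∈ _
  rw [conj_toC, toC_mem_centralizer_iff]
  exact act_conj_frameChange hact

theorem conj_s_eq (o : Fin n) : h hω o * s hω o * (s hω o ^ 3 * h hω o * s hω o * h hω o * s hω o) *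
    (h hω o * s hω o)⁻¹ = s hω o := by
  have h1 : s hω o * s hω o ^ 3 = 1 := by rw [← pow_succ', s_pow_four]
  have h2 := h_mul_self (hω := hω) o
  generalize s hω o = a at *
  generalize h hω o = b at *
  calc b * a * (a ^ 3 * b * a * b * a) * (b * a)⁻¹ =
      b * (a * a ^ 3) * b * a * (b * a) * (b * a)⁻¹ := by simp only [mul_assoc]
    _ = a := by rw [h1, mul_one, h2, one_mul, mul_inv_cancel_right]

theorem inertia_one_conj (h0 : 0 < 1) {ω : ℂ} {hω : IsPrimitiveRoot ω 8} :
    Subgroup.centralizer {s hω ⟨0, h0⟩ ^ 2} =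
      (inertia hω 1).map (MulAut.conj (h hω ⟨0, h0⟩ * s hω ⟨0, h0⟩)).toMonoidHom := by
  apply le_antisymm
  · refine centralizer_le_closure_one h0 ⟨h hω 0, Subgroup.subset_closure (Or.inl rfl), ?_⟩
      ⟨_, Subgroup.subset_closure (Or.inr rfl), conj_s_eq _⟩
    change h hω (0 : Fin 1) * s hω 0 * h hω 0 * (h hω (0 : Fin 1) * s hω 0)⁻¹ = _
    rw [h_mul_s_inv, ← mul_assoc]
    rfl
  · rw [Subgroup.map_le_iff_le_comap, inertia, Subgroup.closure_le]
    rintro _ (rfl | rfl)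
    · exact conj_toC_mem_centralizer _ (act_gateH_add _)
    · rw [SetLike.mem_coe, Subgroup.mem_comap]
      change h hω (0 : Fin 1) * s hω 0 * _ * (h hω (0 : Fin 1) * s hω 0)⁻¹ ∈ _
      rw [conj_s_eq]
      exact (toC_mem_centralizer_iff _).mpr (act_gateS_zLetter hω _ _)

theorem act_add_of_ne {o i : Fin n} (hio : i ≠ o) (A : Matrix.unitaryGroup (Fin 2) ℂ) :
    Act (onQubit i A) (xLetter o + zLetter o) (xLetter o + zLetter o) :=
  (act_onQubit_xLetter hio A).add (act_onQubit_zLetter hio A)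

theorem act_opM {o i : Fin n} (hoi : o ≠ i) :
    Act (opM o i) (xLetter o + zLetter o) (xLetter o + zLetter o) := by
  obtain ⟨g, hg, hy, hx⟩ := exists_opM_eq hoi
  rw [hg]
  have h1 : form (xLetter i) (xLetter o + zLetter o) = 0 := by
    rw [form_add_right, form_xLetter_xLetter, form_comm, form_zLetter_xLetter_of_ne hoi, add_zero]
  -- The inverse of `g` carries `Y_o X_i` to `Y_o` and fixes `X_i`; adding these shows that it also
  -- carries `Y_o` to `Y_o X_i`.
  have h2 : Act g⁻¹ (xLetter o + zLetter o) (xLetter o + zLetter o + xLetter i) := by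
    have := hy.inv.add hx.inv
    rwa [add_assoc _ (xLetter i), word_add_self, add_zero] at this
  have h3 : Act g (xLetter o + zLetter o + xLetter i) (xLetter o + zLetter o) := by
    have := h2.inv
    rwa [inv_inv] at this
  refine Act.mul ((h3.mul (act_rot_of_comm ?_)).mul h2).inv ((h3.mul (act_word _ _)).mul h2)
  rw [form_add_right, form_self, form_comm, h1, add_zero]

theorem M_mem_comap (hn : 2 ≤ n) (h0 : 0 < n) :
    M hω hn ∈ (Subgroup.centralizer {s hω ⟨0, h0⟩ ^ 2}).comap
      (MulAut.conj (h hω ⟨0, h0⟩ * s hω ⟨0, h0⟩)).toMonoidHom := by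
  obtain ⟨hM, hM'⟩ := M_eq (hω := hω) hn h0
  rw [hM']
  exact conj_toC_mem_centralizer _ (act_opM (by simp [Fin.ext_iff]))

theorem h_mul_s_sq_mul_h (i : Fin n) : ∃ hx : word (xLetter i) ∈ clifford n hω,
    h hω i * s hω i ^ 2 * h hω i = toC hω (word (xLetter i)) hx := by
  have h1 : onQubit i gateH * (word (zLetter i) * onQubit i gateH) = word (xLetter i) := by
    rw [← mul_assoc, gateH_mul_word_zLetter, mul_assoc, gateH_mul_self, mul_one]
  have h2 : word (zLetter i) ∈ clifford n hω := by
    rw [← onQubit_gateZ, ← gateS_sq hω, map_mul]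
    exact mul_mem (S_mem hω i) (S_mem hω i)
  refine ⟨h1 ▸ mul_mem (H_mem hω i) (mul_mem h2 (H_mem hω i)), ?_⟩
  rw [s_sq, h, toC_mul, toC_mul]
  exact toC_congr hω h1 _

/-- The criterion is verified in the rotated frame. The letters of the other qubits are unaffected,
`M` replaces the missing `Λ₁`, and only `rot Z₁` requires a case distinction. -/
theorem centralizer_le_map_conj (hn : 2 ≤ n) (h0 : 0 < n) {I : Subgroup (C n hω)}
    (hh : ∀ i, h hω i ∈ I) (hs : ∀ i : Fin n, 1 ≤ i.val → s hω i ∈ I) (hM : M hω hn ∈ I)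
    (hΛ : ∀ (k : ℕ) (hk : k + 1 < n), 1 ≤ k → Λ hω k hk ∈ I)
    (hX : n = 2 → h hω ⟨0, h0⟩ * s hω ⟨0, h0⟩ ^ 2 * h hω ⟨0, h0⟩ ∈ I) :
    Subgroup.centralizer {s hω ⟨0, h0⟩ ^ 2} ≤
      I.map (MulAut.conj (h hω ⟨0, h0⟩ * s hω ⟨0, h0⟩)).toMonoidHom := by
  set o : Fin n := ⟨0, h0⟩ with ho
  set N := I.map (MulAut.conj (h hω o * s hω o)).toMonoidHom with hN
  have hne : ∀ i : Fin n, 1 ≤ i.val → o ≠ i := by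
    rintro i hi rfl
    simp [ho] at hi
  have hp := phases_le_preimage N
  have transfer : ∀ {v w}, Act (frameChange hω o) v w → rot v ∈ preimage hω I →
      rot w ∈ preimage hω N := fun hact hv => hact.conj_rot_mem.mp (conj_mem_preimage_map o hv)
  have transfer_word : ∀ {v w}, Act (frameChange hω o) v w → word v ∈ preimage hω I →
      word w ∈ preimage hω N := fun hact hv =>
    (hact.conj_word_mem hp).mp (conj_mem_preimage_map o hv)
  have hxI : ∀ i : Fin n, 1 ≤ i.val → rot (xLetter i) ∈ preimage hω I := fun i hi =>
    rot_xLetter_mem (hh i) (hs i hi)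
  have hx : ∀ i : Fin n, 1 ≤ i.val → rot (xLetter i) ∈ preimage hω N := fun i hi =>
    transfer (act_frameChange_xLetter_of_ne (hne i hi)) (hxI i hi)
  have hz : ∀ i : Fin n, 1 ≤ i.val → rot (zLetter i) ∈ preimage hω N := fun i hi =>
    transfer (act_frameChange_zLetter_of_ne (hne i hi)) (rot_zLetter_mem (hs i hi))
  -- Removing the factor `X₂` from `M` leaves a rotation about `Y₁X₂` or its inverse, and the frame
  -- change turns `Y₁X₂` into `Z₁X₂`.
  have h01 : rot (zLetter o + xLetter ⟨1, hn⟩) ∈ preimage hω N := by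
    have hne1 := hne ⟨1, hn⟩ le_rfl
    refine transfer ((act_frameChange_add o).add (act_frameChange_xLetter_of_ne hne1)) ?_
    obtain ⟨hM1, hM2⟩ := M_eq (hω := hω) hn h0
    obtain ⟨g, hg, hgy, hgx⟩ := exists_opM_eq hne1
    rw [hM2, toC_mem_iff, hg, Subgroup.mul_mem_cancel_right, inv_mem_iff, hgy.conj_rot_mem] at hM
    · exact hM
    · exact (hgx.conj_word_mem (phases_le_preimage I)).mpr
        (word_mem_of_rot_mem (phases_le_preimage I) (hxI _ le_rfl))
  have hzx : ∀ (k : ℕ) (hk : k + 1 < n),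
      rot (zLetter (⟨k, by omega⟩ : Fin n) + xLetter ⟨k + 1, hk⟩) ∈ preimage hω N := by
    intro k hk
    rcases Nat.eq_zero_or_pos k with rfl | hk0
    · exact h01
    · exact transfer ((act_frameChange_zLetter_of_ne (hne ⟨k, by omega⟩ hk0)).add
        (act_frameChange_xLetter_of_ne (hne _ (by simp))))
        (rot_zLetter_add_xLetter_mem hk (hΛ k hk hk0) (hxI _ (by simp)))
  have hT : h hω o * s hω o * h hω o * s hω o ^ 3 * h hω o ∈ N := by
    rw [conj_h_eq, toC_mem_iff]
    exact conj_mem_preimage_map o ((toC_mem_iff _).mp (hh o))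
  suffices hz0 : rot (zLetter o) ∈ preimage hω N from
    centralizer_le_of_rot_mem h0 (word_xLetter_mem hT hz0) hz0 hx hz hzx
  rcases Nat.eq_or_lt_of_le hn with hn2 | hn3
  -- For two qubits the extra generator, the class of `X₁`, becomes `Y₁`. The word `Z₁` is the
  -- product of `Z₁X₂` and `X₂`, so `X₁` is available and `hT` gives `rot Z₁`.
  · refine rot_zLetter_mem_of_word_mem hT ?_
    obtain ⟨hx', hX'⟩ := h_mul_s_sq_mul_h (hω := hω) o
    have hy : word (xLetter o + zLetter o) ∈ preimage hω N :=
      transfer_word (act_frameChange_xLetter o) ((toC_mem_iff _).mp (hX' ▸ hX hn2.symm))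
    have hzw : word (zLetter o) ∈ preimage hω N := by
      have := word_add_mem hp (word_mem_of_rot_mem hp h01)
        (word_mem_of_rot_mem hp (hx ⟨1, hn⟩ le_rfl))
      rwa [add_assoc, word_add_self, add_zero] at this
    have := word_add_mem hp hy hzw
    rwa [add_assoc, word_add_self, add_zero] at this
  -- With a third qubit, the relation for `Z₁`, `Z₂`, `Z₃` contains `rot Z₁` and six rotations about
  -- other diagonal words, all available.
  · have hmem : ∀ b : Basis n, ((0, b) : Word n) ≠ zLetter o → rot ((0, b) : Word n) ∈
        preimage hω N := fun b hb =>
      rot_mem_of_generators h0 hp hx hz hzx (by rw [form_zLetter_left]; rfl) hb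
    have hneq : ∀ (b : Basis n) (i : Fin n), 1 ≤ i.val → b i = 1 → ((0, b) : Word n) ≠ zLetter o := by
      intro b i hi hb he
      have := congrArg (fun v : Word n => v.2 i) he
      simp [zLetter, hb, (hne i hi).symm] at this
    have h12 : (⟨1, hn⟩ : Fin n) ≠ ⟨2, hn3⟩ := by simp [Fin.ext_iff]
    have h1o : (⟨1, hn⟩ : Fin n) ≠ o := (hne _ (by simp)).symm
    have h2o : (⟨2, hn3⟩ : Fin n) ≠ o := (hne _ (by simp)).symm
    obtain ⟨c, hc⟩ := rot_mul_rot_mul_rot_diagonal (Pi.single o 1 : Basis n)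
      (Pi.single ⟨1, hn⟩ 1) (Pi.single ⟨2, hn3⟩ 1)
    have hprod : rot ((0, Pi.single o 1) : Word n) * rot (0, Pi.single ⟨1, hn⟩ 1) *
        rot (0, Pi.single ⟨2, hn3⟩ 1) *
        rot (0, Pi.single o 1 + Pi.single ⟨1, hn⟩ 1 + Pi.single ⟨2, hn3⟩ 1) ∈ preimage hω N := by
      refine (mul_mem_phases_iff hp hc).mpr (mul_mem (mul_mem ?_ ?_) ?_)
      · exact hmem _ (hneq _ ⟨1, hn⟩ le_rfl (by simp [h1o]))
      · exact hmem _ (hneq _ ⟨2, hn3⟩ (by simp) (by simp [h2o]))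
      · exact hmem _ (hneq _ ⟨1, hn⟩ le_rfl (by simp [h12]))
    rwa [Subgroup.mul_mem_cancel_right, Subgroup.mul_mem_cancel_right,
      Subgroup.mul_mem_cancel_right] at hprod
    · exact hmem _ (hneq _ ⟨1, hn⟩ le_rfl (by simp))
    · exact hmem _ (hneq _ ⟨2, hn3⟩ (by simp) (by simp))
    · exact hmem _ (hneq _ ⟨1, hn⟩ le_rfl (by simp [h1o, h12]))

theorem act_gateCZ_add {i j o : Fin n} (hi : i ≠ o) (hj : j ≠ o) :
    Act (gateCZ i j) (xLetter o + zLetter o) (xLetter o + zLetter o) :=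
  (act_gateCZ_xLetter_of_ne hi hj).add (act_gateCZ_zLetter i j o)

/-- One inclusion comes from generation. For the other, apart from the second generator for `n = 1`,
which is conjugated to `s₁` directly, each generator is seen to fix `Y₁` up to a scalar. -/
theorem inertia_conj (hn : 1 ≤ n) : Subgroup.centralizer {s hω ⟨0, hn⟩ ^ 2} =
    (inertia hω n).map (MulAut.conj (h hω ⟨0, hn⟩ * s hω ⟨0, hn⟩)).toMonoidHom := by
  have hgate : ∀ (i : Fin n) (A : Matrix.unitaryGroup (Fin 2) ℂ)
      (hA : onQubit i A ∈ clifford n hω), i ≠ ⟨0, hn⟩ → toC hω (onQubit i A) hA ∈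
        (Subgroup.centralizer {s hω ⟨0, hn⟩ ^ 2}).comap
          (MulAut.conj (h hω ⟨0, hn⟩ * s hω ⟨0, hn⟩)).toMonoidHom := fun i A hA hi =>
    conj_toC_mem_centralizer hA (act_add_of_ne hi A)
  have hh : ∀ i, h hω i ∈ (Subgroup.centralizer {s hω ⟨0, hn⟩ ^ 2}).comap
      (MulAut.conj (h hω ⟨0, hn⟩ * s hω ⟨0, hn⟩)).toMonoidHom := by
    intro i
    by_cases hi : i = ⟨0, hn⟩
    · subst hi
      exact conj_toC_mem_centralizer _ (act_gateH_add _)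
    · exact hgate i _ _ hi
  match n, hn with
  | 1, hn => exact inertia_one_conj hn
  | 2, hn =>
    apply le_antisymm
    · refine centralizer_le_map_conj le_rfl hn ?_ ?_ ?_ ?_ ?_
      · intro i
        refine Subgroup.subset_closure ?_
        fin_cases i
        · exact Or.inl rfl
        · exact Or.inr (Or.inl rfl)
      · intro i hi
        obtain rfl : i = 1 := Fin.ext (by have := i.isLt; simp; omega)
        exact Subgroup.subset_closure (Or.inr (Or.inr (Or.inl rfl)))
      · exact Subgroup.subset_closure (Or.inr (Or.inr (Or.inr (Or.inr rfl))))
      · intro k hk hk'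
        omega
      · intro _
        exact Subgroup.subset_closure (Or.inr (Or.inr (Or.inr (Or.inl rfl))))
    · rw [Subgroup.map_le_iff_le_comap, inertia, Subgroup.closure_le]
      rintro _ (rfl | rfl | rfl | rfl | rfl)
      · exact hh _
      · exact hh _
      · exact hgate 1 _ _ (by simp)
      · obtain ⟨hx, hX⟩ := h_mul_s_sq_mul_h (hω := hω) (0 : Fin 2)
        rw [hX]
        exact conj_toC_mem_centralizer _ (act_word _ _)
      · exact M_mem_comap le_rfl hn
  | n + 3, hn =>
    apply le_antisymm
    · refine centralizer_le_map_conj (by omega) hn (fun i => ?_) (fun i hi => ?_) ?_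
        (fun k hk hk' => ?_) (fun h2 => by omega)
      · exact Subgroup.subset_closure (Or.inl (Or.inl (Or.inl ⟨i, rfl⟩)))
      · exact Subgroup.subset_closure (Or.inl (Or.inl (Or.inr
          ⟨i, by rintro rfl; simp at hi, rfl⟩)))
      · exact Subgroup.subset_closure (Or.inl (Or.inr rfl))
      · exact Subgroup.subset_closure (Or.inr ⟨k, hk, hk', rfl⟩)
    · rw [Subgroup.map_le_iff_le_comap, inertia, Subgroup.closure_le]
      rintro _ (((⟨i, rfl⟩ | ⟨i, hi, rfl⟩) | rfl) | ⟨k, hk, hk', rfl⟩)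
      · exact hh i
      · exact hgate i _ _ hi
      · exact M_mem_comap _ hn
      · refine conj_toC_mem_centralizer _ (act_gateCZ_add ?_ ?_)
        · simp [Fin.ext_iff]; omega
        · simp [Fin.ext_iff]

end subgroups

end ProjClifford

/-! ### The theorem -/

theorem mainTheorem2 (ω : ℂ) (hω : IsPrimitiveRoot ω 8) (n : ℕ) (hn : 1 ≤ n)
    (h₁ s₁ : ProjClifford.C n hω)
    (hh₁ : h₁ = ProjClifford.h hω ⟨0, hn⟩) (hs₁ : s₁ = ProjClifford.s hω ⟨0, hn⟩) :
    (n = 1 → Subgroup.centralizer {s₁ ^ 2} =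
      Subgroup.closure {h₁ * s₁ * h₁ * s₁ ^ 3 * h₁, s₁}) ∧
    (2 ≤ n → Subgroup.centralizer {s₁ ^ 2} =
      Subgroup.closure ({h₁ * s₁ * h₁ * s₁ ^ 3 * h₁} ∪
        {u | ∃ i : Fin n, 1 ≤ i.val ∧ u = ProjClifford.h hω i} ∪
        {u | ∃ i : Fin n, u = ProjClifford.s hω i} ∪
        {u | ∃ (k : ℕ) (hk : k + 1 < n), u = ProjClifford.Λ hω k hk})) ∧
    (2 ≤ n → Subgroup.centralizer {s₁ ^ 2} =
      Subgroup.closure ({h₁ * s₁ * h₁ * s₁ ^ 3 * h₁} ∪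
        {u | ∃ i : Fin n, 1 ≤ i.val ∧ u = ProjClifford.h hω i} ∪
        {u | ∃ i : Fin n, 1 ≤ i.val ∧ u = ProjClifford.s hω i} ∪
        {u | ∃ (k : ℕ) (hk : k + 1 < n), u = ProjClifford.Λ hω k hk})) ∧
    ((Subgroup.centralizer {s₁ ^ 2} : Set (ProjClifford.C n hω)) =
      {g | ∃ u ∈ ProjClifford.inertia hω n, g = h₁ * s₁ * u * s₁ ^ 3 * h₁}) ∧
    (∃ c : ProjClifford.C n hω, Subgroup.centralizer {s₁ ^ 2} =
      (ProjClifford.inertia hω n).map (MulAut.conj c).toMonoidHom) := by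
  subst hh₁ hs₁
  have hmono : Subgroup.closure ({ProjClifford.h hω ⟨0, hn⟩ * ProjClifford.s hω ⟨0, hn⟩ *
        ProjClifford.h hω ⟨0, hn⟩ * ProjClifford.s hω ⟨0, hn⟩ ^ 3 * ProjClifford.h hω ⟨0, hn⟩} ∪
        {u | ∃ i : Fin n, 1 ≤ i.val ∧ u = ProjClifford.h hω i} ∪
        {u | ∃ i : Fin n, 1 ≤ i.val ∧ u = ProjClifford.s hω i} ∪
        {u | ∃ (k : ℕ) (hk : k + 1 < n), u = ProjClifford.Λ hω k hk}) ≤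
      Subgroup.closure ({ProjClifford.h hω ⟨0, hn⟩ * ProjClifford.s hω ⟨0, hn⟩ *
        ProjClifford.h hω ⟨0, hn⟩ * ProjClifford.s hω ⟨0, hn⟩ ^ 3 * ProjClifford.h hω ⟨0, hn⟩} ∪
        {u | ∃ i : Fin n, 1 ≤ i.val ∧ u = ProjClifford.h hω i} ∪
        {u | ∃ i : Fin n, u = ProjClifford.s hω i} ∪
        {u | ∃ (k : ℕ) (hk : k + 1 < n), u = ProjClifford.Λ hω k hk}) := by
    refine Subgroup.closure_mono (Set.union_subset_union_left _ (Set.union_subset_union_right _ ?_))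
    rintro _ ⟨i, -, rfl⟩
    exact ⟨i, rfl⟩
  refine ⟨?_, fun h2 => ?_, fun h2 => ?_, ?_, ⟨_, ProjClifford.inertia_conj hn⟩⟩
  · rintro rfl
    apply le_antisymm
    · exact ProjClifford.centralizer_le_closure_one hn (Subgroup.subset_closure (Or.inl rfl))
        (Subgroup.subset_closure (Or.inr rfl))
    · rw [Subgroup.closure_le]
      rintro _ (rfl | rfl)
      · exact ProjClifford.conj_h_mem_centralizer _
      · exact (ProjClifford.toC_mem_centralizer_iff _).mpr (ProjClifford.act_gateS_zLetter hω _ _)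
  · exact le_antisymm ((ProjClifford.centralizer_le_closure h2 hn).trans hmono)
      (ProjClifford.closure_le_centralizer hn)
  · exact le_antisymm (ProjClifford.centralizer_le_closure h2 hn)
      (hmono.trans (ProjClifford.closure_le_centralizer hn))
  · rw [ProjClifford.inertia_conj hn]
    ext g
    refine exists_congr fun u => and_congr_right fun _ => ?_
    -- The right factor `s₁³ h₁` is the inverse of `h₁ s₁`, so the set is the conjugate subgroup.
    rw [eq_comm, mul_assoc _ (ProjClifford.s hω ⟨0, hn⟩ ^ 3), ← ProjClifford.h_mul_s_inv]
    rfl
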